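/- Let $n,m\ge 1$. For $t,\delta>0$ and $\epsilon\ge 0$ put $$\mathcal A_{(t,\delta,\epsilon)}=\Big\{\vec y\in(\mathbb R^n)^m:\ \delta(1-\epsilon)t<\sum_{i=1}^m|y_i|\le 2\delta(1+\epsilon)t\Big\}.$$ Let $\phi\in\mathfrak D$, that is, $\phi:(\mathbb R^n)^m\to[0,\infty)$ is locally integrable and there are constants $\delta,\epsilon,C>0$ such that $$\sup_{\vec v\in\mathcal A_{(2^k,1,0)}}\phi(\vec v)\le \frac{C}{2^{knm}}\int_{\mathcal A_{(2^k,\delta,\epsilon)}}\phi(\vec y)\,d\vec y\qquad\text{for every }k\in\mathbb Z .$$ Fix such $\delta,\epsilon$. For $0<\theta\le1$ and $t>0$ let $$\Phi_\theta(t)=\Big[\sum_{\nu\in\mathbb Z,\ 2^{-\nu}\le t}\Big(\int_{\mathcal A_{(2^{-\nu},\delta,\epsilon)}}\phi(\vec y)\,d\vec y\Big)^{\theta}\Big]^{1/\theta}\in[0,\infty].$$ For a cube $Q$ (with sides parallel to the axes and side length $l(Q)$) and $\ell\in\{0,1\}$ let $$\|f\|_{L(\log L)^\ell,Q}=\inf\Big\{\lambda>0:\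 \frac1{|Q|}\int_Q B_\ell\Big(\frac{|f(y)|}{\lambda}\Big)dy\le 1\Big\},\qquad B_\ell(t)=t(1+\log^+t)^\ell ,$$ so that $\|f\|_{L(\log L)^0,Q}=\|f\|_{L,Q}=\frac1{|Q|}\int_Q|f|$, and for $\vec f=(f_1,\dots,f_m)$ let $$\mathcal M_{\Phi_\theta,L(\log L)^\ell}\vec f(x)=\sup_{Q\ni x}\Phi_\theta(l(Q))\prod_{i=1}^m\|f_i\|_{L(\log L)^\ell,Q}\qquad(0\cdot\infty=0).$$ Let $$\mathcal T_\phi\vec f(x)=\int_{(\mathbb R^n)^m}\phi(x-y_1,\dots,x-y_m)\prod_{i=1}^m f_i(y_i)\,d\vec y ,$$ and, for $\vec b=(b_1,\dots,b_m)\in BMO^m$ with $\|\vec b\|_*=\max_j\|b_j\|_{BMO}$, $$\mathcal T_{\vec b,\phi}\vec f(x)=\sum_{j=1}^m\Big(b_j(x)\,\mathcal T_\phi\vec f(x)-\mathcal T_\phi(f_1,\dots,b_jf_j,\dots,f_m)(x)\Big).$$ Write $\mathcal T_{\vec b^0,\phi}=\mathcal T_\phi$ and $\mathcal T_{\vec b^1,\phi}=\mathcal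 T_{\vec b,\phi}$. Let $w\in A_\infty=\bigcup_{r>1}A_r$. All constants below are finite and independent of $\vec f$, and depend on $\vec b$ only through an upper bound for $\|\vec b\|_*$; the inequalities hold for all $\vec f=(f_1,\dots,f_m)$ with every $f_i$ (measurable,) bounded with compact support. (i) If $0<p\le1$, there is a constant $C_0$ such that $$\int_{\mathbb R^n}|\mathcal T_\phi\vec f|^p\,w\,dx\le C_0\int_{\mathbb R^n}\big[\mathcal M_{\Phi_p,L}\vec f\,\big]^p\,w\,dx .$$ (ii) If $0<p\le 1$ and $w\in RH(1/p)$, i.e. $\big(\frac1{|Q|}\int_Qw^{1/p}\big)^{p}\le \frac{C}{|Q|}\int_Qw$ for all cubes $Q$ with $C$ independent of $Q$ (no condition when $p=1$), there is a constant $C_1$ such that $$\int_{\mathbb R^n}|\mathcal T_{\vec b,\phi}\vec f|^p\,w\,dx\le C_1\int_{\mathbb R^n}\big[\mathcal M_{\Phi_p,L\log L}\vec f\,\big]^p\,w\,dx .$$ (iii) If $1<p<\infty$ and $\ell\in\{0,1\}$, there is a constant $C_\ell$ such that $$\int_{\mathbb R^n}|\mathcal T_{\vec b^\ell,\phi}\vec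 f|^p\,w\,dx\le C_\ell\int_{\mathbb R^n}\big[\mathcal M_{\Phi_1,L(\log L)^\ell}\vec f\,\big]^p\,w\,dx .$$ -/

import Mathlib

open MeasureTheory Real
open scoped ENNReal NNReal

noncomputable section

namespace MultilinearPotential

/-- `ℝⁿ` with the Euclidean norm. -/
abbrev Rn (n : ℕ) : Type := EuclideanSpace ℝ (Fin n)

/-- The closed cube with sides parallel to the axes, lower corner `a` and side length `l`. -/
def cube {n : ℕ} (a : Rn n) (l : ℝ) : Set (Rn n) :=
  {y | ∀ i, a i ≤ y i ∧ y i ≤ a i + l}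

/-- The annulus `δ(1-ε)t < ∑ |yᵢ| ≤ δ(1+ε)2t` in `(ℝⁿ)ᵐ`. -/
def annulus (n m : ℕ) (t δ ε : ℝ) : Set (Fin m → Rn n) :=
  {y | δ * (1 - ε) * t < ∑ i, ‖y i‖ ∧ ∑ i, ‖y i‖ ≤ δ * (1 + ε) * (2 * t)}

/-- `φ ∈ 𝔇`, with the witnessing constants `δ` and `ε` displayed: `φ` is nonnegative, locally
integrable, and `sup_{𝒜(2ᵏ,1,0)} φ ≤ C 2^{-knm} ∫_{𝒜(2ᵏ,δ,ε)} φ` for all `k ∈ ℤ`. -/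
structure CondD {n m : ℕ} (φ : (Fin m → Rn n) → ℝ) (δ ε : ℝ) : Prop where
  nonneg : ∀ y, 0 ≤ φ y
  locallyIntegrable : LocallyIntegrable φ
  delta_pos : 0 < δ
  eps_pos : 0 < ε
  growth : ∃ C : ℝ, 0 < C ∧ ∀ k : ℤ, ∀ v ∈ annulus n m ((2 : ℝ) ^ k) 1 0,
    φ v ≤ C / (2 : ℝ) ^ (k * n * m) * ∫ y in annulus n m ((2 : ℝ) ^ k) δ ε, φ y

/-- `Φ_θ(t) = [∑_{ν ≥ log_{1/2} t} (∫_{𝒜(2^{-ν},δ,ε)} φ)^θ]^{1/θ}`, a value in `[0,∞]`;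
for `t > 0` the condition `ν ≥ log_{1/2} t` says `2^{-ν} ≤ t`. -/
def Phi {n m : ℕ} (φ : (Fin m → Rn n) → ℝ) (δ ε θ t : ℝ) : ℝ≥0∞ :=
  (∑' ν : {ν : ℤ // (2 : ℝ) ^ (-ν) ≤ t},
    (∫⁻ y in annulus n m ((2 : ℝ) ^ (-ν.1)) δ ε, ENNReal.ofReal (φ y)) ^ θ) ^ (1 / θ)

/-- The multilinear potential operator `𝒯_φ`. -/
def potential {n m : ℕ} (φ : (Fin m → Rn n) → ℝ) (f : Fin m → Rn n → ℝ) (x : Rn n) : ℝ :=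
  ∫ y : Fin m → Rn n, φ (fun i => x - y i) * ∏ i, f i (y i)

/-- The commutator `𝒯_{b,φ} f = ∑ⱼ (bⱼ 𝒯_φ f - 𝒯_φ(f₁,…,bⱼfⱼ,…,f_m))`. -/
def commutator {n m : ℕ} (b : Fin m → Rn n → ℝ) (φ : (Fin m → Rn n) → ℝ)
    (f : Fin m → Rn n → ℝ) (x : Rn n) : ℝ :=
  ∑ j, (b j x * potential φ f x
    - potential φ (Function.update f j (fun y => b j y * f j y)) x)

/-- `𝒯_{b^ℓ,φ}`: the potential operator for `ℓ = 0`, the commutator for `ℓ = 1`. -/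
def potentialComm {n m : ℕ} (ℓ : Fin 2) (b : Fin m → Rn n → ℝ) (φ : (Fin m → Rn n) → ℝ)
    (f : Fin m → Rn n → ℝ) (x : Rn n) : ℝ :=
  if ℓ = 0 then potential φ f x else commutator b φ f x

/-- The function `t (1 + log⁺ t)^ℓ` defining `L(log L)^ℓ` (so `L` for `ℓ = 0`). -/
def youngLog (ℓ : ℕ) (t : ℝ) : ℝ := t * (1 + posLog t) ^ ℓ

/-- The Luxemburg average `inf {λ > 0 : |Q|⁻¹ ∫_Q B(|f|/λ) ≤ 1}` of `f` over `Q`. -/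
def luxAvg {n : ℕ} (B : ℝ → ℝ) (f : Rn n → ℝ) (Q : Set (Rn n)) : ℝ≥0∞ :=
  ⨅ (r : ℝ) (_ : 0 < r) (_ : ⨍⁻ y in Q, ENNReal.ofReal (B (|f y| / r)) ∂volume ≤ 1),
    ENNReal.ofReal r

/-- The multilinear maximal operator `sup_{Q ∋ x} Ψ(l(Q)) ∏ᵢ ‖fᵢ‖_{L^B,Q}`. -/
def maximal {n m : ℕ} (Ψ : ℝ → ℝ≥0∞) (B : ℝ → ℝ) (f : Fin m → Rn n → ℝ) (x : Rn n) : ℝ≥0∞ :=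
  ⨆ (a : Rn n) (l : ℝ) (_ : 0 < l) (_ : x ∈ cube a l), Ψ l * ∏ i, luxAvg B (f i) (cube a l)

/-- A weight: a locally integrable function that is positive almost everywhere. -/
structure IsWeight {n : ℕ} (w : Rn n → ℝ) : Prop where
  locallyIntegrable : LocallyIntegrable w
  pos : ∀ᵐ x, 0 < w x

/-- Muckenhoupt's condition `A_r`, `1 < r < ∞`. -/
def MemA {n : ℕ} (r : ℝ) (w : Rn n → ℝ) : Prop :=
  IsWeight w ∧ ∃ C : ℝ≥0, ∀ (a : Rn n) (l : ℝ), 0 < l →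
    (⨍⁻ y in cube a l, ENNReal.ofReal (w y) ∂volume) *
      (⨍⁻ y in cube a l, ENNReal.ofReal (w y) ^ (-(1 / (r - 1))) ∂volume) ^ (r - 1) ≤ C

/-- `A_∞ = ⋃_{r > 1} A_r`. -/
def MemAInfty {n : ℕ} (w : Rn n → ℝ) : Prop := ∃ r : ℝ, 1 < r ∧ MemA r w

/-- The reverse Hölder condition `RH(s)` (no condition on a weight for `s = 1`). -/
def MemRH {n : ℕ} (s : ℝ) (w : Rn n → ℝ) : Prop :=
  IsWeight w ∧ ∃ C : ℝ≥0, ∀ (a : Rn n) (l : ℝ), 0 < l →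
    (⨍⁻ y in cube a l, ENNReal.ofReal (w y) ^ s ∂volume) ^ (1 / s) ≤
      C * ⨍⁻ y in cube a l, ENNReal.ofReal (w y) ∂volume

/-- `‖b‖_* = sup_Q |Q|⁻¹ ∫_Q |b - b_Q|`, for locally integrable `b`. -/
def bmoNorm {n : ℕ} (b : Rn n → ℝ) : ℝ≥0∞ :=
  ⨆ (a : Rn n) (l : ℝ) (_ : 0 < l),
    ⨍⁻ y in cube a l, ‖b y - ⨍ z in cube a l, b z ∂volume‖ₑ ∂volume

/-- `b ∈ BMO`. -/
def MemBMO {n : ℕ} (b : Rn n → ℝ) : Prop := LocallyIntegrable b ∧ bmoNorm b < ∞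

/-- `‖b‖_* = sup_j ‖bⱼ‖_*` for a vector of symbols. -/
def bmoNormVec {n m : ℕ} (b : Fin m → Rn n → ℝ) : ℝ≥0∞ := ⨆ j, bmoNorm (b j)

/-- Every `fᵢ` is measurable and bounded with compact support. -/
def BddCompactSupp {n m : ℕ} (f : Fin m → Rn n → ℝ) : Prop :=
  ∀ i, AEStronglyMeasurable (f i) ∧ (∃ K : ℝ, ∀ x, |f i x| ≤ K) ∧ HasCompactSupport (f i)

end MultilinearPotential

end

open MeasureTheory Real
open scoped ENNReal NNReal

noncomputable section

namespace MultilinearPotential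

section Sparse

lemma ennreal_add_rpow_le (a x : ℝ≥0∞) {s : ℝ} (hs : 1 ≤ s) :
    (a + x) ^ s ≤ a ^ s + ENNReal.ofReal s * (x * (a + x) ^ (s - 1)) := by
  have hs0 : 0 < s := by linarith
  rcases eq_or_ne a ∞ with rfl | ha
  · simp [hs0]
  rcases eq_or_ne x ∞ with rfl | hx
  · rcases eq_or_lt_of_le hs with rfl | h1
    · simp
    · have : (0 : ℝ) < s - 1 := by linarith
      simp [hs0, this, ENNReal.top_rpow_of_pos, ENNReal.mul_top]
  lift a to ℝ≥0 using ha
  lift x to ℝ≥0 using hx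
  by_cases h0 : a + x = 0
  · have : ((a : ℝ≥0∞) + x) = 0 := by exact_mod_cast h0
    simp [this, hs0]
  have hpos : (0 : ℝ) < (a : ℝ) + x := by
    have : 0 < a + x := pos_iff_ne_zero.2 h0
    exact_mod_cast this
  have key : ((a : ℝ) + x) ^ s ≤ (a : ℝ) ^ s + s * (x * ((a : ℝ) + x) ^ (s - 1)) := by
    have hu : (-1 : ℝ) ≤ -(x / (a + x)) := by
      rw [neg_le_neg_iff, div_le_one hpos]
      linarith [a.coe_nonneg]
    have hB := one_add_mul_self_le_rpow_one_add hu hs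
    have e1 : 1 + -((x : ℝ) / (a + x)) = a / (a + x) := by field_simp; ring
    rw [e1, Real.div_rpow a.coe_nonneg hpos.le] at hB
    have hP : 0 < ((a : ℝ) + x) ^ s := Real.rpow_pos_of_pos hpos s
    rw [le_div_iff₀ hP] at hB
    have e2 : ((a : ℝ) + x) ^ (s - 1) = ((a : ℝ) + x) ^ s / (a + x) := by
      rw [Real.rpow_sub hpos, Real.rpow_one]
    rw [e2]
    have e3 : (1 + s * -((x : ℝ) / (a + x))) * ((a : ℝ) + x) ^ s
        = ((a : ℝ) + x) ^ s - s * (x * (((a : ℝ) + x) ^ s / (a + x))) := by ring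
    linarith
  have hs1 : 0 ≤ s - 1 := by linarith
  rw [← ENNReal.coe_add, ← ENNReal.coe_rpow_of_nonneg _ hs0.le,
    ← ENNReal.coe_rpow_of_nonneg _ hs0.le, ← ENNReal.coe_rpow_of_nonneg _ hs1, ENNReal.ofReal,
    ← ENNReal.coe_mul, ← ENNReal.coe_mul, ← ENNReal.coe_add, ENNReal.coe_le_coe,
    ← NNReal.coe_le_coe]
  push_cast
  rw [Real.coe_toNNReal _ hs0.le]
  exact key

variable {X ι : Type*} [MeasurableSpace X] {μ : Measure X}

/-- Power of a sum over a nested family, expanded along the chain of sets containing a point. -/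
lemma lintegral_sum_indicator_rpow_le_chain (lev : ι → ℕ) (A : ι → Set X)
    (hA : ∀ i, MeasurableSet (A i))
    (hnest : ∀ i j, lev i ≤ lev j → Disjoint (A i) (A j) ∨ A j ⊆ A i)
    (c : ι → ℝ≥0∞) {s : ℝ} (hs : 1 ≤ s) (T : Finset ι) :
    ∫⁻ x, (∑ i ∈ T, (A i).indicator (fun _ => c i) x) ^ s ∂μ ≤
      ENNReal.ofReal s * ∑ i ∈ T, c i *
        (⨅ x ∈ A i, ∑ j ∈ T, (A j).indicator (fun _ => c j) x) ^ (s - 1) * μ (A i) := by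
  classical
  have hs0 : 0 < s := by linarith
  have hs1 : 0 ≤ s - 1 := by linarith
  induction T using Finset.induction_on_max_value lev with
  | empty => simp [hs0]
  | insert a T haT hmax ih =>
    have hmeas : ∀ T : Finset ι,
        Measurable (fun x => ∑ i ∈ T, (A i).indicator (fun _ => c i) x) := fun T =>
      Finset.measurable_sum _ fun i _ => measurable_const.indicator (hA i)
    set L : ι → ℝ≥0∞ := fun i => ⨅ x ∈ A i, ∑ j ∈ insert a T, (A j).indicator (fun _ => c j) x
      with hL
    have hpt : ∀ x, (∑ i ∈ insert a T, (A i).indicator (fun _ => c i) x) ^ s ≤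
        (∑ i ∈ T, (A i).indicator (fun _ => c i) x) ^ s +
          (A a).indicator (fun _ => ENNReal.ofReal s * (c a * L a ^ (s - 1))) x := by
      intro x
      by_cases hx : x ∈ A a
      · have hle : ∑ i ∈ insert a T, (A i).indicator (fun _ => c i) x ≤ L a := by
          refine le_iInf₂ fun y hy => Finset.sum_le_sum fun j hj => ?_
          by_cases hxj : x ∈ A j
          · have hlev : lev j ≤ lev a := by
              rcases Finset.mem_insert.1 hj with rfl | hj
              · exact le_rfl
              · exact hmax j hj
            rcases hnest j a hlev with hd | hsub
            · exact absurd hx (Set.disjoint_left.1 hd hxj)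
            · rw [Set.indicator_of_mem hxj, Set.indicator_of_mem (hsub hy)]
          · simp [hxj]
        rw [Set.indicator_of_mem hx]
        have h1 := ennreal_add_rpow_le (∑ i ∈ T, (A i).indicator (fun _ => c i) x) (c a) hs
        have h2 : ∑ i ∈ insert a T, (A i).indicator (fun _ => c i) x
            = ∑ i ∈ T, (A i).indicator (fun _ => c i) x + c a := by
          rw [Finset.sum_insert haT, Set.indicator_of_mem hx, add_comm]
        rw [h2] at hle ⊢
        refine h1.trans ?_
        gcongr
      · rw [Finset.sum_insert haT, Set.indicator_of_notMem hx, Set.indicator_of_notMem hx]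
        simp
    calc ∫⁻ x, (∑ i ∈ insert a T, (A i).indicator (fun _ => c i) x) ^ s ∂μ
        ≤ ∫⁻ x, ((∑ i ∈ T, (A i).indicator (fun _ => c i) x) ^ s +
          (A a).indicator (fun _ => ENNReal.ofReal s * (c a * L a ^ (s - 1))) x) ∂μ :=
          lintegral_mono hpt
      _ = ∫⁻ x, (∑ i ∈ T, (A i).indicator (fun _ => c i) x) ^ s ∂μ +
          ENNReal.ofReal s * (c a * L a ^ (s - 1)) * μ (A a) := by
          rw [lintegral_add_left ((hmeas T).pow_const s), lintegral_indicator_const (hA a)]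
      _ ≤ ENNReal.ofReal s * ∑ i ∈ T, c i * L i ^ (s - 1) * μ (A i) +
          ENNReal.ofReal s * (c a * L a ^ (s - 1)) * μ (A a) := by
          gcongr
          refine ih.trans ?_
          gcongr with i hi
          refine iInf₂_mono fun x hx => ?_
          exact Finset.sum_le_sum_of_subset (Finset.subset_insert a T)
      _ = ENNReal.ofReal s * ∑ i ∈ insert a T, c i * L i ^ (s - 1) * μ (A i) := by
          rw [Finset.sum_insert haT]; ring

lemma lintegral_sum_indicator_rpow_le (lev : ι → ℕ) (A E : ι → Set X)
    (hA : ∀ i, MeasurableSet (A i)) (hE : ∀ i, MeasurableSet (E i)) (hEA : ∀ i, E i ⊆ A i)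
    (hnest : ∀ i j, lev i ≤ lev j → Disjoint (A i) (A j) ∨ A j ⊆ A i)
    {C : ℝ≥0} (hC : ∀ i, μ (A i) ≤ C * μ (E i))
    (c : ι → ℝ≥0∞) {s : ℝ} (hs : 1 ≤ s) (T : Finset ι) :
    ∫⁻ x, (∑ i ∈ T, (A i).indicator (fun _ => c i) x) ^ s ∂μ ≤
      (ENNReal.ofReal s * C) ^ s *
        ∫⁻ x, (∑ i ∈ T, (E i).indicator (fun _ => c i) x) ^ s ∂μ := by
  classical
  have hs0 : 0 < s := by linarith
  have hs1 : 0 ≤ s - 1 := by linarith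
  set G : X → ℝ≥0∞ := fun x => ∑ i ∈ T, (A i).indicator (fun _ => c i) x with hG
  set H : X → ℝ≥0∞ := fun x => ∑ i ∈ T, (E i).indicator (fun _ => c i) x with hH
  have hGm : Measurable G := Finset.measurable_sum _ fun i _ => measurable_const.indicator (hA i)
  have hHm : Measurable H := Finset.measurable_sum _ fun i _ => measurable_const.indicator (hE i)
  have h1 : ∫⁻ x, G x ^ s ∂μ ≤ ENNReal.ofReal s * (C * ∫⁻ x, H x * G x ^ (s - 1) ∂μ) := by
    refine (lintegral_sum_indicator_rpow_le_chain lev A hA hnest c hs T).trans ?_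
    gcongr
    calc ∑ i ∈ T, c i * (⨅ x ∈ A i, G x) ^ (s - 1) * μ (A i)
        ≤ ∑ i ∈ T, C * ∫⁻ x, (E i).indicator (fun _ => c i) x * G x ^ (s - 1) ∂μ := by
          refine Finset.sum_le_sum fun i _ => ?_
          calc c i * (⨅ x ∈ A i, G x) ^ (s - 1) * μ (A i)
              ≤ c i * (⨅ x ∈ A i, G x) ^ (s - 1) * (C * μ (E i)) := by gcongr; exact hC i
            _ = C * ∫⁻ x, (E i).indicator
                  (fun _ => c i * (⨅ x ∈ A i, G x) ^ (s - 1)) x ∂μ := by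
                rw [lintegral_indicator_const (hE i)]; ring
            _ ≤ _ := by
                gcongr with x
                by_cases hx : x ∈ E i
                · rw [Set.indicator_of_mem hx, Set.indicator_of_mem hx]
                  gcongr
                  exact iInf₂_le x (hEA i hx)
                · simp [hx]
      _ = C * ∫⁻ x, H x * G x ^ (s - 1) ∂μ := by
          rw [← Finset.mul_sum, ← lintegral_finsetSum]
          · simp_rw [hH, Finset.sum_mul]
          · intro i _
            exact (measurable_const.indicator (hE i)).mul (hGm.pow_const _)
  rcases eq_or_lt_of_le hs with rfl | hs'
  · simp only [ENNReal.rpow_one, sub_self, ENNReal.rpow_zero, mul_one] at h1 ⊢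
    rwa [mul_assoc]
  have hs2 : 0 < s - 1 := by linarith
  set Xs := ∫⁻ x, G x ^ s ∂μ with hX
  set Y := ∫⁻ x, H x ^ s ∂μ with hY
  have hconj : s.HolderConjugate (s / (s - 1)) := Real.HolderConjugate.conjExponent hs'
  have hHol : ∫⁻ x, H x * G x ^ (s - 1) ∂μ ≤ Y ^ (1 / s) * Xs ^ ((s - 1) / s) := by
    refine (ENNReal.lintegral_mul_le_Lp_mul_Lq μ hconj hHm.aemeasurable
      (hGm.pow_const (s - 1)).aemeasurable).trans ?_
    have e : ∀ x, (G x ^ (s - 1)) ^ (s / (s - 1)) = G x ^ s := fun x => by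
      rw [← ENNReal.rpow_mul]; congr 1; field_simp
    simp_rw [e, one_div_div]
    rfl
  by_cases hYtop : Y = ∞
  · by_cases hC0 : C = 0
    · have : ∫⁻ x, G x ^ s ∂μ = 0 := by
        refine le_antisymm (h1.trans ?_) bot_le
        simp [hC0]
      rw [hX, this]; exact bot_le
    · rw [hYtop, ENNReal.mul_top]
      · exact le_top
      · refine (ENNReal.rpow_pos (ENNReal.mul_pos ?_ ?_) ?_).ne'
        · simpa using hs0
        · simpa using hC0
        · exact ENNReal.mul_ne_top ENNReal.ofReal_ne_top ENNReal.coe_ne_top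
  have hXfin : Xs ≠ ∞ := by
    have hterm : ∀ i ∈ T, c i ^ s * μ (A i) ≠ ∞ := by
      intro i hi
      have hle : c i ^ s * μ (E i) ≤ Y := by
        rw [← lintegral_indicator_const (hE i)]
        refine lintegral_mono fun x => ?_
        by_cases hx : x ∈ E i
        · rw [Set.indicator_of_mem hx]
          refine ENNReal.rpow_le_rpow ?_ hs0.le
          refine le_trans (le_of_eq ?_) (Finset.single_le_sum
            (f := fun i => (E i).indicator (fun _ => c i) x) (fun _ _ => bot_le) hi)
          simp [hx]
        · simp [hx]
      refine ne_top_of_le_ne_top (ENNReal.mul_ne_top (ENNReal.coe_ne_top (r := C)) hYtop)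
        (le_trans ?_ (mul_le_mul_right hle (C : ℝ≥0∞)))
      calc c i ^ s * μ (A i) ≤ c i ^ s * (C * μ (E i)) := by gcongr; exact hC i
        _ = C * (c i ^ s * μ (E i)) := by ring
    have hle : Xs ≤ ∑ i ∈ T, (T.card : ℝ≥0∞) ^ (s - 1) * (c i ^ s * μ (A i)) := by
      calc Xs ≤ ∫⁻ x, (T.card : ℝ≥0∞) ^ (s - 1) *
            ∑ i ∈ T, (A i).indicator (fun _ => c i ^ s) x ∂μ := by
            refine lintegral_mono fun x => ?_
            refine (ENNReal.rpow_sum_le_const_mul_sum_rpow T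
              (fun i => (A i).indicator (fun _ => c i) x) hs).trans (le_of_eq ?_)
            congr 1
            refine Finset.sum_congr rfl fun i _ => ?_
            by_cases hx : x ∈ A i <;> simp [hx, hs0]
        _ = _ := by
            rw [lintegral_const_mul _ (Finset.measurable_sum _ fun i _ =>
              measurable_const.indicator (hA i)), lintegral_finsetSum _ (fun i _ =>
              measurable_const.indicator (hA i)), Finset.mul_sum]
            simp_rw [lintegral_indicator_const (hA _)]
    refine ne_top_of_le_ne_top ?_ hle
    refine (ENNReal.sum_lt_top.2 fun i hi => ?_).ne
    exact ENNReal.mul_lt_top (ENNReal.rpow_lt_top_of_nonneg hs1 (by simp))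
      (hterm i hi).lt_top
  by_cases hX0 : Xs = 0
  · rw [hX0]; exact bot_le
  have h2 : Xs ≤ ENNReal.ofReal s * C * Y ^ (1 / s) * Xs ^ ((s - 1) / s) := by
    refine h1.trans ?_
    calc _ ≤ ENNReal.ofReal s * (C * (Y ^ (1 / s) * Xs ^ ((s - 1) / s))) := by gcongr
      _ = _ := by ring
  have h3 : Xs ^ (1 / s) ≤ ENNReal.ofReal s * C * Y ^ (1 / s) := by
    have e : Xs = Xs ^ (1 / s) * Xs ^ ((s - 1) / s) := by
      rw [← ENNReal.rpow_add _ _ hX0 hXfin, ← add_div]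
      simp [hs0.ne']
    have hne0 : Xs ^ ((s - 1) / s) ≠ 0 := (ENNReal.rpow_pos (pos_iff_ne_zero.2 hX0) hXfin).ne'
    have hneT : Xs ^ ((s - 1) / s) ≠ ∞ := ENNReal.rpow_ne_top_of_nonneg (by positivity) hXfin
    exact (ENNReal.mul_le_mul_iff_left hne0 hneT).1 (e ▸ h2)
  have h4 := ENNReal.rpow_le_rpow h3 hs0.le
  rwa [ENNReal.mul_rpow_of_nonneg _ _ hs0.le, ← ENNReal.rpow_mul, ← ENNReal.rpow_mul,
    one_div_mul_cancel hs0.ne', ENNReal.rpow_one, ENNReal.rpow_one] at h4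

/-- The `Lˢ` bound for sums over a countable sparse nested family. -/
lemma lintegral_tsum_indicator_rpow_le [Countable ι] (lev : ι → ℕ) (A E : ι → Set X)
    (hA : ∀ i, MeasurableSet (A i)) (hE : ∀ i, MeasurableSet (E i)) (hEA : ∀ i, E i ⊆ A i)
    (hnest : ∀ i j, lev i ≤ lev j → Disjoint (A i) (A j) ∨ A j ⊆ A i)
    {C : ℝ≥0} (hC : ∀ i, μ (A i) ≤ C * μ (E i))
    (c : ι → ℝ≥0∞) {s : ℝ} (hs : 1 ≤ s) :
    ∫⁻ x, (∑' i, (A i).indicator (fun _ => c i) x) ^ s ∂μ ≤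
      (ENNReal.ofReal s * C) ^ s *
        ∫⁻ x, (∑' i, (E i).indicator (fun _ => c i) x) ^ s ∂μ := by
  have hs0 : 0 < s := by linarith
  have e : ∀ x, (∑' i, (A i).indicator (fun _ => c i) x) ^ s =
      ⨆ T : Finset ι, (∑ i ∈ T, (A i).indicator (fun _ => c i) x) ^ s := fun x => by
    rw [ENNReal.tsum_eq_iSup_sum, ← ENNReal.orderIsoRpow_apply s hs0, OrderIso.map_iSup]
    rfl
  simp_rw [e]
  rw [lintegral_iSup_directed]
  · refine iSup_le fun T => (lintegral_sum_indicator_rpow_le lev A E hA hE hEA hnest hC c hs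
      T).trans ?_
    gcongr
    exact ENNReal.sum_le_tsum _
  · intro T
    exact ((Finset.measurable_sum _ fun i _ =>
      measurable_const.indicator (hA i)).pow_const s).aemeasurable
  · refine Monotone.directed_le fun T T' hT x => ?_
    exact ENNReal.rpow_le_rpow (Finset.sum_le_sum_of_subset hT) hs0.le

end Sparse

section Tree

variable {X Z : Type*}

open Classical in
/-- The principal cell of the cell `(t, z)` for the stopping relation `bad`. -/
def principal (par : ℕ → Z → Z) (bad : ℕ × Z → ℕ × Z → Prop) : ℕ → Z → ℕ × Z
  | 0, z => (0, z)
  | t + 1, z => if bad (t + 1, z) (principal par bad t (par t z)) then (t + 1, z)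
      else principal par bad t (par t z)

/-- The cell `(t, z)` of the tree of level sets of `ζ`. -/
def cell (ζ : ℕ → X → Z) (S : ℕ × Z) : Set X := {x | ζ S.1 x = S.2}

/-- The principal cell at depth `t` of the point `x`. -/
def principalAt (ζ : ℕ → X → Z) (par : ℕ → Z → Z) (bad : ℕ × Z → ℕ × Z → Prop) (t : ℕ) (x : X) :
    ℕ × Z := principal par bad t (ζ t x)

/-- The stopping cells. -/
abbrev StopCell (par : ℕ → Z → Z) (bad : ℕ × Z → ℕ × Z → Prop) : Type _ :=
  {S : ℕ × Z // principal par bad S.1 S.2 = S}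

/-- The points of a stopping cell that lie in no smaller stopping cell. -/
def coreSet (ζ : ℕ → X → Z) (par : ℕ → Z → Z) (bad : ℕ × Z → ℕ × Z → Prop) (S : ℕ × Z) : Set X :=
  {x | ∀ t, S.1 ≤ t → principalAt ζ par bad t x = S}

/-- The number of stopping cells at depth at least `u` that contain `x`. -/
def stopCount (ζ : ℕ → X → Z) (par : ℕ → Z → Z) (bad : ℕ × Z → ℕ × Z → Prop) (u : ℕ) (x : X) :
    ℝ≥0∞ :=
  ∑' _ : {v : ℕ // u ≤ v ∧ principalAt ζ par bad v x = (v, ζ v x)}, 1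

variable {ζ : ℕ → X → Z} {par : ℕ → Z → Z} {bad : ℕ × Z → ℕ × Z → Prop}

lemma principalAt_zero (x : X) : principalAt ζ par bad 0 x = (0, ζ 0 x) := rfl

section
variable (hpar : ∀ t x, ζ t x = par t (ζ (t + 1) x))
include hpar

open Classical in
lemma principalAt_succ (t : ℕ) (x : X) : principalAt ζ par bad (t + 1) x =
    if bad (t + 1, ζ (t + 1) x) (principalAt ζ par bad t x) then (t + 1, ζ (t + 1) x)
      else principalAt ζ par bad t x := by
  have e : principalAt ζ par bad t x = principal par bad t (par t (ζ (t + 1) x)) := by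
    rw [principalAt, ← hpar t x]
  rw [e]
  rfl

lemma principalAt_spec (t : ℕ) (x : X) :
    (principalAt ζ par bad t x).1 ≤ t ∧
    (principalAt ζ par bad t x).2 = ζ (principalAt ζ par bad t x).1 x ∧
    principalAt ζ par bad (principalAt ζ par bad t x).1 x = principalAt ζ par bad t x := by
  classical
  induction t with
  | zero => simp [principalAt_zero]
  | succ t ih =>
    by_cases h : bad (t + 1, ζ (t + 1) x) (principalAt ζ par bad t x)
    · have e : principalAt ζ par bad (t + 1) x = (t + 1, ζ (t + 1) x) := by
        rw [principalAt_succ hpar, if_pos h]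
      rw [e]
      exact ⟨le_rfl, rfl, e⟩
    · have e : principalAt ζ par bad (t + 1) x = principalAt ζ par bad t x := by
        rw [principalAt_succ hpar, if_neg h]
      rw [e]
      exact ⟨ih.1.trans (Nat.le_succ t), ih.2⟩

lemma principalAt_mono (x : X) : Monotone fun t => (principalAt ζ par bad t x).1 := by
  classical
  refine monotone_nat_of_le_succ fun t => ?_
  rw [principalAt_succ hpar]
  split_ifs
  · exact (principalAt_spec hpar t x).1.trans (Nat.le_succ t)
  · exact le_rfl

/-- A cell is either its own principal cell or not bad relative to it. -/
lemma principalAt_eq_or_not_bad (t : ℕ) (x : X) :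
    principalAt ζ par bad t x = (t, ζ t x) ∨
      ¬ bad (t, ζ t x) (principalAt ζ par bad t x) := by
  classical
  cases t with
  | zero => left; rfl
  | succ t =>
    by_cases h : bad (t + 1, ζ (t + 1) x) (principalAt ζ par bad t x)
    · left; rw [principalAt_succ hpar, if_pos h]
    · right; rw [principalAt_succ hpar, if_neg h]; exact h

lemma level_eq_of_le {t u : ℕ} (htu : t ≤ u) {x y : X} (h : ζ u x = ζ u y) : ζ t x = ζ t y := by
  induction u, htu using Nat.le_induction with
  | base => exact h
  | succ u _ ih => exact ih (by rw [hpar u x, hpar u y, h])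

lemma cell_nested (S T : ℕ × Z) (h : S.1 ≤ T.1) :
    Disjoint (cell ζ S) (cell ζ T) ∨ cell ζ T ⊆ cell ζ S := by
  by_cases hd : Disjoint (cell ζ S) (cell ζ T)
  · exact Or.inl hd
  · right
    obtain ⟨x, hxS, hxT⟩ := Set.not_disjoint_iff.1 hd
    intro y hy
    have : ζ T.1 y = ζ T.1 x := (show ζ T.1 y = T.2 from hy).trans hxT.symm
    exact (level_eq_of_le hpar h this).trans hxS

lemma coreSet_subset (S : ℕ × Z) : coreSet ζ par bad S ⊆ cell ζ S := by
  intro x hx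
  have h := hx S.1 le_rfl
  have := (principalAt_spec hpar (bad := bad) S.1 x).2.1
  rw [h] at this
  exact this.symm

omit hpar in
lemma coreSet_disjoint {S T : ℕ × Z} (h : S ≠ T) :
    Disjoint (coreSet ζ par bad S) (coreSet ζ par bad T) := by
  refine Set.disjoint_left.2 fun x hS hT => h ?_
  exact (hS (max S.1 T.1) (le_max_left _ _)).symm.trans (hT (max S.1 T.1) (le_max_right _ _))

/-- The maximal bad cells in a stopping cell. -/
def stopChildren (par : ℕ → Z → Z) (bad : ℕ × Z → ℕ × Z → Prop) (S : ℕ × Z) : Set (ℕ × Z) :=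
  {C | ∃ t z, C = (t + 1, z) ∧ S.1 ≤ t ∧ principal par bad t (par t z) = S ∧ bad C S}

lemma cell_diff_coreSet_subset (S : StopCell par bad) :
    cell ζ S.1 \ coreSet ζ par bad S.1 ⊆ ⋃ C ∈ stopChildren par bad S.1, cell ζ C := by
  classical
  rintro x ⟨hx, hxE⟩
  have h0 : principalAt ζ par bad S.1.1 x = S.1 := by
    rw [principalAt, show ζ S.1.1 x = S.1.2 from hx, S.2]
  by_contra hcon
  apply hxE
  intro t ht
  induction t, ht using Nat.le_induction with
  | base => exact h0
  | succ t ht ih =>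
    by_cases h : bad (t + 1, ζ (t + 1) x) (principalAt ζ par bad t x)
    · exfalso
      apply hcon
      refine Set.mem_biUnion (x := (t + 1, ζ (t + 1) x)) ⟨t, _, rfl, ht, ?_, ?_⟩ rfl
      · rw [← hpar t x]; exact ih
      · rwa [ih] at h
    · rw [principalAt_succ hpar, if_neg h, ih]

lemma principalAt_of_mem_cell_stopChildren {S C : ℕ × Z} (hC : C ∈ stopChildren par bad S)
    {x : X} (hx : x ∈ cell ζ C) : ∃ t, C.1 = t + 1 ∧ S.1 ≤ t ∧ principalAt ζ par bad t x = S ∧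
      principalAt ζ par bad (t + 1) x = C := by
  classical
  obtain ⟨t, z, rfl, hle, hp, hb⟩ := hC
  have hz : ζ (t + 1) x = z := hx
  have h1 : principalAt ζ par bad t x = S := by rw [principalAt, hpar t x, hz, hp]
  refine ⟨t, rfl, hle, h1, ?_⟩
  rw [principalAt_succ hpar, h1, hz, if_pos hb]

lemma cell_stopChildren_subset {S C : ℕ × Z} (hC : C ∈ stopChildren par bad S) :
    cell ζ C ⊆ cell ζ S := by
  intro x hx
  obtain ⟨t, -, -, h, -⟩ := principalAt_of_mem_cell_stopChildren hpar hC hx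
  have := (principalAt_spec hpar (bad := bad) t x).2.1
  rw [h] at this
  exact this.symm

lemma cell_stopChildren_disjoint {S C D : ℕ × Z} (hC : C ∈ stopChildren par bad S)
    (hD : D ∈ stopChildren par bad S) (hne : C ≠ D) : Disjoint (cell ζ C) (cell ζ D) := by
  refine Set.disjoint_left.2 fun x hxC hxD => hne ?_
  obtain ⟨t, htC, hSt, h1, h2⟩ := principalAt_of_mem_cell_stopChildren hpar hC hxC
  obtain ⟨u, huD, hSu, h3, h4⟩ := principalAt_of_mem_cell_stopChildren hpar hD hxD
  rcases lt_trichotomy t u with h | h | h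
  · have := principalAt_mono hpar (bad := bad) x (show t + 1 ≤ u from h)
    simp only [h2, h3] at this
    omega
  · subst h; rw [← h2, h4]
  · have := principalAt_mono hpar (bad := bad) x (show u + 1 ≤ t from h)
    simp only [h4, h1] at this
    omega

lemma one_le_stopCount (t : ℕ) (x : X) :
    1 ≤ stopCount ζ par bad (principalAt ζ par bad t x).1 x := by
  have h := principalAt_spec hpar (bad := bad) t x
  refine le_trans ?_ (ENNReal.le_tsum
    (⟨(principalAt ζ par bad t x).1, le_rfl, ?_⟩ : {v : ℕ // (principalAt ζ par bad t x).1 ≤ v ∧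
      principalAt ζ par bad v x = (v, ζ v x)}))
  · exact le_rfl
  · rw [h.2.2]; exact Prod.ext rfl h.2.1

omit hpar in
lemma stopCount_le_tsum (u : ℕ) (x : X) : stopCount ζ par bad u x ≤
    ∑' S : StopCell par bad, if u ≤ S.1.1 then (cell ζ S.1).indicator (fun _ => 1) x else 0 := by
  let g : {v : ℕ // u ≤ v ∧ principalAt ζ par bad v x = (v, ζ v x)} → StopCell par bad :=
    fun v => ⟨(v.1, ζ v.1 x), v.2.2⟩
  have hg : Function.Injective g := fun v w h => Subtype.ext (congrArg (fun S => S.1.1) h)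
  refine le_trans (le_of_eq ?_) (ENNReal.tsum_comp_le_tsum_of_injective hg _)
  refine tsum_congr fun v => ?_
  have : x ∈ cell ζ (g v).1 := rfl
  rw [if_pos v.2.1, Set.indicator_of_mem this]

/-- Telescoping along the stopping cells containing `x`. -/
lemma edist_le_stopCount (β : ℕ → ℝ) {κ κ' : ℝ≥0} (x : X)
    (hκ : ∀ t, |β t - β (principalAt ζ par bad t x).1| ≤ κ)
    (hstep : ∀ t, |β (t + 1) - β t| ≤ κ') (S t : ℕ) (hS : principalAt ζ par bad S x = (S, ζ S x))
    (hSt : S ≤ t) :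
    ENNReal.ofReal |β t - β S| ≤ (κ + κ') * stopCount ζ par bad S x := by
  classical
  set F : ℕ → Finset ℕ := fun t =>
    (Finset.Ioc S t).filter fun v => principalAt ζ par bad v x = (v, ζ v x)
  have hmain : ∀ t, S ≤ t →
      |β (principalAt ζ par bad t x).1 - β S| ≤ (κ + κ') * (F t).card := by
    intro t ht
    induction t, ht using Nat.le_induction with
    | base => simp [hS, F]
    | succ t ht ih =>
      by_cases h : bad (t + 1, ζ (t + 1) x) (principalAt ζ par bad t x)
      · have e : principalAt ζ par bad (t + 1) x = (t + 1, ζ (t + 1) x) := by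
          rw [principalAt_succ hpar, if_pos h]
        have hF : F (t + 1) = insert (t + 1) (F t) := by
          ext v
          simp only [F, Finset.mem_filter, Finset.mem_Ioc, Finset.mem_insert]
          constructor
          · rintro ⟨⟨h1, h2⟩, h3⟩
            rcases Nat.lt_or_ge t v with h4 | h4
            · left; omega
            · right; exact ⟨⟨h1, h4⟩, h3⟩
          · rintro (rfl | ⟨⟨h1, h2⟩, h3⟩)
            · exact ⟨⟨by omega, le_rfl⟩, e⟩
            · exact ⟨⟨h1, by omega⟩, h3⟩
        have hn : t + 1 ∉ F t := by simp [F]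
        rw [hF, Finset.card_insert_of_notMem hn, e]
        have h1 := hκ t
        have h2 := hstep t
        have : |β (t + 1) - β S| ≤ |β (t + 1) - β t| +
            |β t - β (principalAt ζ par bad t x).1| +
            |β (principalAt ζ par bad t x).1 - β S| := by
          have e3 : β (t + 1) - β S = (β (t + 1) - β t) +
            (β t - β (principalAt ζ par bad t x).1) +
            (β (principalAt ζ par bad t x).1 - β S) := by ring
          rw [e3]
          exact abs_add_three _ _ _
        push_cast
        linarith
      · have e : principalAt ζ par bad (t + 1) x = principalAt ζ par bad t x := by
          rw [principalAt_succ hpar, if_neg h]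
        rw [e]
        refine ih.trans ?_
        have hsub : F t ⊆ F (t + 1) := by
          intro v
          simp only [F, Finset.mem_filter, Finset.mem_Ioc]
          rintro ⟨⟨h1, h2⟩, h3⟩
          exact ⟨⟨h1, by omega⟩, h3⟩
        have := Finset.card_le_card hsub
        gcongr
  have hcount : ((F t).card : ℝ≥0∞) + 1 ≤ stopCount ζ par bad S x := by
    have hn : S ∉ F t := by simp [F]
    have hc : ((F t).card : ℝ≥0∞) + 1 = ∑ v ∈ insert S (F t), 1 := by
      rw [Finset.sum_const, Finset.card_insert_of_notMem hn, nsmul_one, Nat.cast_add,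
        Nat.cast_one]
    have hmem : ∀ v ∈ insert S (F t), S ≤ v ∧ principalAt ζ par bad v x = (v, ζ v x) := by
      intro v hv
      rcases Finset.mem_insert.1 hv with rfl | hv
      · exact ⟨le_rfl, hS⟩
      · simp only [F, Finset.mem_filter, Finset.mem_Ioc] at hv
        exact ⟨hv.1.1.le, hv.2⟩
    rw [hc, stopCount]
    refine le_trans (le_of_eq ?_) (ENNReal.sum_le_tsum ((insert S (F t)).subtype
      fun v => S ≤ v ∧ principalAt ζ par bad v x = (v, ζ v x)))
    rw [Finset.sum_const, Finset.sum_const, Finset.card_subtype, Finset.filter_true_of_mem hmem]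
  have h1 := hmain t hSt
  have h2 := hκ t
  have h3 : |β t - β S| ≤ (κ + κ') * ((F t).card + 1) := by
    have := abs_sub_le (β t) (β (principalAt ζ par bad t x).1) (β S)
    have hk' := κ'.coe_nonneg
    linarith
  calc ENNReal.ofReal |β t - β S| ≤ ENNReal.ofReal ((κ + κ') * ((F t).card + 1)) :=
        ENNReal.ofReal_le_ofReal h3
    _ = (κ + κ') * ((F t).card + 1) := by
        rw [ENNReal.ofReal_mul (add_nonneg κ.coe_nonneg κ'.coe_nonneg),
          ENNReal.ofReal_add κ.coe_nonneg κ'.coe_nonneg,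
          ENNReal.ofReal_add (Nat.cast_nonneg _) zero_le_one, ENNReal.ofReal_coe_nnreal,
          ENNReal.ofReal_coe_nnreal, ENNReal.ofReal_natCast, ENNReal.ofReal_one]
    _ ≤ _ := by gcongr

end

section Measure

variable [MeasurableSpace X] {μ : Measure X}

lemma measurableSet_cell [MeasurableSpace Z] [MeasurableSingletonClass Z]
    (hζ : ∀ t, Measurable (ζ t)) (S : ℕ × Z) : MeasurableSet (cell ζ S) :=
  hζ S.1 (measurableSet_singleton S.2)

lemma measurableSet_coreSet [Countable Z] [MeasurableSpace Z] [MeasurableSingletonClass Z]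
    (hζ : ∀ t, Measurable (ζ t)) (S : ℕ × Z) : MeasurableSet (coreSet ζ par bad S) := by
  have : coreSet ζ par bad S =
      ⋂ t, ⋂ (_ : S.1 ≤ t), ζ t ⁻¹' {z | principal par bad t z = S} := by
    ext x; simp [coreSet, principalAt]
  rw [this]
  exact MeasurableSet.iInter fun t => MeasurableSet.iInter fun _ =>
    hζ t (Set.to_countable _).measurableSet

/-- If bad cells fill at most half of each cell, the core of a stopping cell has at least half
of its measure. -/
lemma measure_cell_le_two_mul_coreSet [Countable Z] (hpar : ∀ t x, ζ t x = par t (ζ (t + 1) x))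
    (hfin : ∀ S, μ (cell ζ S) ≠ ∞)
    (hbad : ∀ S, ∀ T : Finset (ℕ × Z), (∀ C ∈ T, cell ζ C ⊆ cell ζ S) → (∀ C ∈ T, bad C S) →
      (T : Set (ℕ × Z)).PairwiseDisjoint (cell ζ) →
      2 * ∑ C ∈ T, μ (cell ζ C) ≤ μ (cell ζ S)) (S : StopCell par bad) :
    μ (cell ζ S.1) ≤ 2 * μ (coreSet ζ par bad S.1) := by
  set Ch := stopChildren par bad S.1
  have hsum : 2 * ∑' C : Ch, μ (cell ζ C.1) ≤ μ (cell ζ S.1) := by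
    rw [ENNReal.tsum_eq_iSup_sum, ENNReal.mul_iSup]
    refine iSup_le fun T => ?_
    have := hbad S.1 (T.map (Function.Embedding.subtype _)) ?_ ?_ ?_
    · simpa using this
    · intro C hC
      obtain ⟨D, -, rfl⟩ := Finset.mem_map.1 hC
      exact cell_stopChildren_subset hpar D.2
    · intro C hC
      obtain ⟨D, -, rfl⟩ := Finset.mem_map.1 hC
      obtain ⟨t, z, -, -, -, h⟩ := D.2
      exact h
    · intro C hC D hD hne
      obtain ⟨C', -, rfl⟩ := Finset.mem_map.1 (Finset.mem_coe.1 hC)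
      obtain ⟨D', -, rfl⟩ := Finset.mem_map.1 (Finset.mem_coe.1 hD)
      exact cell_stopChildren_disjoint hpar C'.2 D'.2 hne
  have hdiff : μ (cell ζ S.1 \ coreSet ζ par bad S.1) ≤ ∑' C : Ch, μ (cell ζ C.1) := by
    refine (measure_mono (cell_diff_coreSet_subset hpar S)).trans ?_
    exact measure_biUnion_le μ (Set.to_countable _) _
  have hle : 2 * μ (cell ζ S.1) ≤ μ (cell ζ S.1) + 2 * μ (coreSet ζ par bad S.1) := by
    calc 2 * μ (cell ζ S.1) ≤ 2 * (μ (cell ζ S.1 \ coreSet ζ par bad S.1) +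
          μ (coreSet ζ par bad S.1)) := by
          gcongr
          refine (measure_mono ?_).trans (measure_union_le _ _)
          rw [Set.sdiff_union_self]; exact Set.subset_union_left
      _ ≤ _ := by
          rw [mul_add]; gcongr
          exact (mul_le_mul_right hdiff 2).trans hsum
  rw [two_mul] at hle
  exact (ENNReal.add_le_add_iff_left (hfin S.1)).1 hle

end Measure

end Tree

section Cubes

variable {n : ℕ}

lemma cube_eq_preimage_Icc (a : Rn n) (l : ℝ) :
    cube a l = WithLp.ofLp ⁻¹' Set.Icc (WithLp.ofLp a) (fun i => a i + l) := by
  ext y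
  simp only [cube, Set.mem_ofPred_eq, Set.mem_preimage, Set.mem_Icc, Pi.le_def, forall_and]

lemma measurableSet_cube (a : Rn n) (l : ℝ) : MeasurableSet (cube a l) := by
  rw [cube_eq_preimage_Icc]
  exact (PiLp.volume_preserving_ofLp (Fin n)).measurable measurableSet_Icc

lemma volume_cube (a : Rn n) (l : ℝ) : volume (cube a l) = ENNReal.ofReal l ^ n := by
  rw [cube_eq_preimage_Icc, (PiLp.volume_preserving_ofLp (Fin n)).measure_preimage
    measurableSet_Icc.nullMeasurableSet, Real.volume_Icc_pi]
  simp

lemma volume_cube_ne_top (a : Rn n) (l : ℝ) : volume (cube a l) ≠ ∞ := by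
  rw [volume_cube]; exact ENNReal.pow_ne_top ENNReal.ofReal_ne_top

lemma volume_cube_ne_zero (a : Rn n) {l : ℝ} (hl : 0 < l) : volume (cube a l) ≠ 0 := by
  rw [volume_cube]; exact pow_ne_zero _ (by simpa using hl)

lemma isCompact_cube (a : Rn n) (l : ℝ) : IsCompact (cube a l) := by
  have h : cube a l = WithLp.toLp 2 '' Set.Icc (WithLp.ofLp a) (fun i => a i + l) := by
    rw [cube_eq_preimage_Icc]
    ext y
    constructor
    · intro hy; exact ⟨_, hy, rfl⟩
    · rintro ⟨z, hz, rfl⟩; exact hz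
  rw [h]
  exact isCompact_Icc.image (PiLp.continuous_toLp 2 _)

lemma cube_eq_preimage_closedBall (a : Rn n) {l : ℝ} (hl : 0 ≤ l) :
    cube a l = WithLp.ofLp ⁻¹' Metric.closedBall (fun i => a i + l / 2) (l / 2) := by
  ext y
  simp only [cube, Set.mem_ofPred_eq, Set.mem_preimage, closedBall_pi _ (by linarith : 0 ≤ l / 2),
    Set.mem_pi, Set.mem_univ, true_imp_iff, Real.closedBall_eq_Icc, Set.mem_Icc]
  refine forall_congr' fun i => ?_
  constructor <;> rintro ⟨h1, h2⟩ <;> constructor <;> linarith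

end Cubes

section Grid

variable {n : ℕ}

/-- The sign `(-1)ᵏ`. -/
def gridSign (k : ℤ) : ℤ := if Even k then 1 else -1

lemma gridSign_succ (k : ℤ) : gridSign (k + 1) = -gridSign k := by
  unfold gridSign
  by_cases h : Even k
  · have : ¬ Even (k + 1) := by simpa [Int.even_add_one] using h
    rw [if_pos h, if_neg this]
  · have : Even (k + 1) := by simpa [Int.even_add_one] using h
    rw [if_neg h, if_pos this]; norm_num

/-- The index of the cube of side `2ᵏ` containing `x` in the shifted dyadic grid `α`. -/
def gridIndex (α : Fin n → Fin 2) (k : ℤ) (x : Rn n) : Fin n → ℤ :=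
  fun i => ⌊x i / 2 ^ k - gridSign k * (α i : ℕ) / 3⌋

/-- The index of the cube of side `2ᵏ⁺¹` containing the cube of side `2ᵏ` with index `z`. -/
def gridParent (α : Fin n → Fin 2) (k : ℤ) (z : Fin n → ℤ) : Fin n → ℤ :=
  fun i => (z i + gridSign k * (α i : ℕ)) / 2

/-- The lower corner of a grid cube. -/
def gridCorner (α : Fin n → Fin 2) (k : ℤ) (z : Fin n → ℤ) : Rn n :=
  WithLp.toLp 2 fun i => 2 ^ k * (z i + gridSign k * (α i : ℕ) / 3)

/-- A closed cube of a shifted dyadic grid. -/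
def gridCube (α : Fin n → Fin 2) (k : ℤ) (z : Fin n → ℤ) : Set (Rn n) :=
  cube (gridCorner α k z) (2 ^ k)

lemma gridIndex_succ (α : Fin n → Fin 2) (k : ℤ) (x : Rn n) :
    gridIndex α (k + 1) x = gridParent α k (gridIndex α k x) := by
  ext i
  have h := Int.floor_div_natCast
    (x i / 2 ^ k - gridSign k * (α i : ℕ) / 3 + ((gridSign k * (α i : ℕ) : ℤ) : ℝ)) 2
  rw [Int.floor_add_intCast] at h
  simp only [gridIndex, gridParent]
  rw [← Nat.cast_ofNat (R := ℤ) (n := 2), ← h, gridSign_succ, zpow_add_one₀ two_ne_zero]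
  congr 1
  push_cast
  field_simp
  ring

lemma gridIndex_eq_iff (α : Fin n → Fin 2) (k : ℤ) (x : Rn n) (z : Fin n → ℤ) :
    gridIndex α k x = z ↔
      ∀ i, gridCorner α k z i ≤ x i ∧ x i < gridCorner α k z i + 2 ^ k := by
  rw [funext_iff]
  refine forall_congr' fun i => ?_
  have h2 : (0 : ℝ) < 2 ^ k := by positivity
  simp only [gridIndex, gridCorner, Int.floor_eq_iff]
  set u : ℝ := gridSign k * (α i : ℕ) / 3
  rw [le_sub_iff_add_le, le_div_iff₀ h2, sub_lt_iff_lt_add, div_lt_iff₀ h2]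
  constructor <;> rintro ⟨h3, h4⟩ <;> constructor <;> linarith

lemma setOf_gridIndex_subset (α : Fin n → Fin 2) (k : ℤ) (z : Fin n → ℤ) :
    {x | gridIndex α k x = z} ⊆ gridCube α k z := by
  intro x hx i
  have := (gridIndex_eq_iff α k x z).1 hx i
  exact ⟨this.1, this.2.le⟩

lemma setOf_gridIndex_ae_eq (α : Fin n → Fin 2) (k : ℤ) (z : Fin n → ℤ) :
    ({x | gridIndex α k x = z} : Set (Rn n)) =ᵐ[volume] gridCube α k z := by
  have h1 : ({x | gridIndex α k x = z} : Set (Rn n)) = WithLp.ofLp ⁻¹' (Set.univ.pi fun i =>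
      Set.Ico (gridCorner α k z i) (gridCorner α k z i + 2 ^ k)) := by
    ext x
    simp [gridIndex_eq_iff]
  have h2 : gridCube α k z = WithLp.ofLp ⁻¹' (Set.Icc (fun i => gridCorner α k z i)
      (fun i => gridCorner α k z i + 2 ^ k)) := by
    rw [gridCube, cube_eq_preimage_Icc]
  rw [h1, h2]
  exact (PiLp.volume_preserving_ofLp (Fin n)).quasiMeasurePreserving.preimage_ae_eq
    (Measure.univ_pi_Ico_ae_eq_Icc (μ := fun _ : Fin n => (volume : Measure ℝ)))

lemma restrict_setOf_gridIndex (α : Fin n → Fin 2) (k : ℤ) (z : Fin n → ℤ) :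
    (volume : Measure (Rn n)).restrict {x | gridIndex α k x = z} =
      volume.restrict (gridCube α k z) :=
  Measure.restrict_congr_set (setOf_gridIndex_ae_eq α k z)

lemma volume_setOf_gridIndex (α : Fin n → Fin 2) (k : ℤ) (z : Fin n → ℤ) :
    volume ({x | gridIndex α k x = z} : Set (Rn n)) = volume (gridCube α k z) :=
  measure_congr (setOf_gridIndex_ae_eq α k z)

lemma measurable_gridIndex (α : Fin n → Fin 2) (k : ℤ) :
    Measurable (gridIndex (n := n) α k) := by
  refine measurable_pi_lambda _ fun i => Int.measurable_floor.comp ?_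
  have : Measurable fun x : Rn n => x i :=
    (measurable_pi_apply i).comp (PiLp.volume_preserving_ofLp (Fin n)).measurable
  exact (this.div_const _).sub_const _

/-- Every ball of radius `2ᵏ⁺¹` lies in a cube of side `2ᵏ⁺⁴` of one of the `2ⁿ` grids. -/
lemma exists_closedBall_subset_gridIndex (k : ℤ) (x : Rn n) :
    ∃ α : Fin n → Fin 2, ∀ y : Rn n, ‖x - y‖ ≤ 2 * 2 ^ k →
      gridIndex α (k + 4) y = gridIndex α (k + 4) x := by
  have key : ∀ i, ∃ e : Fin 2, ∀ r : ℝ, |x i - r| ≤ 2 * 2 ^ k →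
      ⌊r / 2 ^ (k + 4) - gridSign (k + 4) * (e : ℕ) / 3⌋ =
        ⌊x i / 2 ^ (k + 4) - gridSign (k + 4) * (e : ℕ) / 3⌋ := by
    intro i
    set u : ℝ := x i / 2 ^ (k + 4) with hu
    have hk : (0 : ℝ) < 2 ^ (k + 4) := by positivity
    have hr : ∀ r : ℝ, |x i - r| ≤ 2 * 2 ^ k → |u - r / 2 ^ (k + 4)| ≤ 1 / 8 := by
      intro r hr
      rw [hu, ← sub_div, abs_div, abs_of_pos hk, div_le_iff₀ hk]
      refine hr.trans (le_of_eq ?_)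
      rw [zpow_add₀ two_ne_zero]; norm_num; ring
    have hs : gridSign (k + 4) = 1 ∨ gridSign (k + 4) = -1 := by
      unfold gridSign; split_ifs <;> simp
    have hfl := Int.floor_le u
    have hfl' := Int.lt_floor_add_one u
    by_cases h : (⌊u⌋ : ℝ) + 1 / 8 ≤ u ∧ u < ⌊u⌋ + 7 / 8
    · refine ⟨0, fun r h1 => ?_⟩
      have h2 := abs_le.1 (hr r h1)
      simp only [Fin.val_zero, Nat.cast_zero, mul_zero, zero_div, sub_zero]
      rw [Int.floor_eq_iff]
      constructor <;> linarith [h.1, h.2, h2.1, h2.2]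
    · refine ⟨1, fun r h1 => ?_⟩
      have h2 := abs_le.1 (hr r h1)
      obtain ⟨m, hm1, hm2⟩ : ∃ m : ℤ, (m : ℝ) - 1 / 8 ≤ u ∧ u < m + 1 / 8 := by
        by_cases h3 : (⌊u⌋ : ℝ) + 1 / 8 ≤ u
        · refine ⟨⌊u⌋ + 1, ?_, ?_⟩ <;> push_cast <;>
            [have := not_lt.1 fun h4 => h ⟨h3, h4⟩; skip] <;> linarith
        · exact ⟨⌊u⌋, by linarith, by linarith [not_le.1 h3]⟩
      rcases hs with hs | hs <;> rw [hs] <;> push_cast <;> simp only [Fin.val_one]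
      · rw [show ⌊u - 1 * ((1 : ℕ) : ℝ) / 3⌋ = m - 1 by
          rw [Int.floor_eq_iff]; push_cast; constructor <;> linarith, Int.floor_eq_iff]
        push_cast
        constructor <;> linarith [h2.1, h2.2]
      · rw [show ⌊u - -1 * ((1 : ℕ) : ℝ) / 3⌋ = m by
          rw [Int.floor_eq_iff]; push_cast; constructor <;> linarith, Int.floor_eq_iff]
        push_cast
        constructor <;> linarith [h2.1, h2.2]
  choose α hα using key
  refine ⟨α, fun y hy => funext fun i => hα i (y i) ?_⟩
  refine le_trans ?_ hy
  have := PiLp.norm_apply_le (x - y) i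
  simpa using this

lemma gridIndex_self (α : Fin n → Fin 2) (k : ℤ) (x : Rn n) :
    x ∈ gridCube α k (gridIndex α k x) := setOf_gridIndex_subset α k _ rfl

lemma locallyIntegrable_comp_toLp {b : Rn n → ℝ} (hb : LocallyIntegrable b) :
    LocallyIntegrable (fun y : Fin n → ℝ => b (WithLp.toLp 2 y)) := by
  rw [locallyIntegrable_iff] at hb ⊢
  intro K hK
  have h := hb _ (hK.image (PiLp.continuous_toLp 2 _))
  have hemb : MeasurableEmbedding (WithLp.toLp 2 : (Fin n → ℝ) → Rn n) :=
    (MeasurableEquiv.toLp 2 (Fin n → ℝ)).measurableEmbedding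
  have := ((PiLp.volume_preserving_toLp (Fin n)).integrableOn_image hemb (f := b) (s := K)).1 h
  exact this

/-- Lebesgue differentiation along the cubes of a shifted dyadic grid. -/
lemma ae_tendsto_average_gridCube (α : Fin n → Fin 2) (N : ℤ) {b : Rn n → ℝ}
    (hb : LocallyIntegrable b) :
    ∀ᵐ x, Filter.Tendsto
      (fun t : ℕ => ⨍ y in gridCube α (N - t) (gridIndex α (N - t) x), b y) Filter.atTop
      (nhds (b x)) := by
  have h := IsUnifLocDoublingMeasure.ae_tendsto_average (volume : Measure (Fin n → ℝ))
    (locallyIntegrable_comp_toLp hb) 1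
  have h' := (PiLp.volume_preserving_ofLp (Fin n)).quasiMeasurePreserving.ae h
  filter_upwards [h'] with x hx
  have hemb : MeasurableEmbedding (WithLp.ofLp : Rn n → (Fin n → ℝ)) :=
    (MeasurableEquiv.toLp 2 (Fin n → ℝ)).symm.measurableEmbedding
  have hpos : ∀ t : ℕ, (0 : ℝ) < 2 ^ (N - t) := fun t => by positivity
  have := hx (ι := ℕ) (l := Filter.atTop)
    (fun t i => gridCorner α (N - t) (gridIndex α (N - t) x) i + 2 ^ (N - (t : ℤ)) / 2)
    (fun t => 2 ^ (N - (t : ℤ)) / 2) ?_ ?_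
  · refine this.congr fun t => ?_
    rw [gridCube, cube_eq_preimage_closedBall _ (hpos t).le, setAverage_eq, setAverage_eq,
      measureReal_def, measureReal_def, (PiLp.volume_preserving_ofLp (Fin n)).measure_preimage
      Metric.isClosed_closedBall.measurableSet.nullMeasurableSet,
      ← (PiLp.volume_preserving_ofLp (Fin n)).setIntegral_preimage_emb hemb]
  · refine tendsto_nhdsWithin_iff.2 ⟨?_, Filter.Eventually.of_forall fun t => ?_⟩
    · have : ∀ t : ℕ, (2 : ℝ) ^ (N - (t : ℤ)) / 2 = 2 ^ N / 2 * (1 / 2) ^ t := fun t => by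
        rw [zpow_sub₀ two_ne_zero, zpow_natCast, one_div, inv_pow]; field_simp
      simp_rw [this]
      simpa using (tendsto_pow_atTop_nhds_zero_of_lt_one (r := (1 / 2 : ℝ)) (by norm_num)
        (by norm_num)).const_mul (2 ^ N / 2 : ℝ)
    · exact half_pos (hpos t)
  · refine Filter.Eventually.of_forall fun t => ?_
    rw [one_mul]
    have h1 := gridIndex_self α (N - t) x
    rw [gridCube, cube_eq_preimage_closedBall _ (hpos t).le] at h1
    exact h1

end Grid

section Weights

variable {n : ℕ}

/-- The weight of a cube is controlled by that of any subset filling half of it. -/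
lemma exists_withDensity_cube_le {w : Rn n → ℝ} (hw : MemAInfty w) :
    ∃ C : ℝ≥0, ∀ (a : Rn n) (l : ℝ), 0 < l → ∀ E ⊆ cube a l, MeasurableSet E →
      volume (cube a l) ≤ 2 * volume E →
      volume.withDensity (fun x => ENNReal.ofReal (w x)) (cube a l) ≤
        C * volume.withDensity (fun x => ENNReal.ofReal (w x)) E := by
  obtain ⟨r, hr, ⟨hwi, hwpos⟩, C, hC⟩ := hw
  have hr0 : 0 < r := by linarith
  have hr1 : 0 < r - 1 := by linarith
  refine ⟨(2 : ℝ≥0) ^ r * C, fun a l hl E hEQ hE hvol => ?_⟩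
  rw [withDensity_apply _ (measurableSet_cube a l), withDensity_apply _ hE]
  set W : Rn n → ℝ≥0∞ := fun x => ENNReal.ofReal (w x) with hW
  have hWm : AEMeasurable W := hwi.aestronglyMeasurable.aemeasurable.ennreal_ofReal
  set σ := ∫⁻ y in cube a l, W y ^ (-(1 / (r - 1))) with hσ
  set V := volume (cube a l) with hV
  have hV0 : V ≠ 0 := volume_cube_ne_zero a hl
  have hVt : V ≠ ∞ := volume_cube_ne_top a l
  have hA : (∫⁻ x in cube a l, W x) * σ ^ (r - 1) ≤ C * V ^ r := by
    have h := hC a l hl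
    rw [setLAverage_eq, setLAverage_eq, ENNReal.div_rpow_of_nonneg _ _ hr1.le] at h
    have e : V ^ r = V * V ^ (r - 1) := by
      conv_lhs => rw [show r = 1 + (r - 1) by ring, ENNReal.rpow_add _ _ hV0 hVt, ENNReal.rpow_one]
    have hVr0 : V ^ (r - 1) ≠ 0 := (ENNReal.rpow_pos (pos_iff_ne_zero.2 hV0) hVt).ne'
    have hVrt : V ^ (r - 1) ≠ ∞ := ENNReal.rpow_ne_top_of_nonneg hr1.le hVt
    rw [div_eq_mul_inv, div_eq_mul_inv] at h
    calc (∫⁻ x in cube a l, W x) * σ ^ (r - 1)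
        = ((∫⁻ x in cube a l, W x) * V⁻¹ * (σ ^ (r - 1) * (V ^ (r - 1))⁻¹)) *
            (V * V ^ (r - 1)) := by
          have e1 : V⁻¹ * V = 1 := ENNReal.inv_mul_cancel hV0 hVt
          have e2 : (V ^ (r - 1))⁻¹ * V ^ (r - 1) = 1 := ENNReal.inv_mul_cancel hVr0 hVrt
          calc _ = (∫⁻ x in cube a l, W x) * σ ^ (r - 1) *
              ((V⁻¹ * V) * ((V ^ (r - 1))⁻¹ * V ^ (r - 1))) := by rw [e1, e2]; simp
            _ = _ := by ring
      _ ≤ C * V ^ r := by rw [e]; gcongr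
  have hconj : r.HolderConjugate (r / (r - 1)) := Real.HolderConjugate.conjExponent hr
  have hH : volume E ^ r ≤ (∫⁻ x in E, W x) * σ ^ (r - 1) := by
    have h1 : volume E ≤ (∫⁻ x in E, W x) ^ (1 / r) * σ ^ ((r - 1) / r) := by
      calc volume E = ∫⁻ x in E, W x ^ (1 / r) * W x ^ (-(1 / r)) := by
            rw [← setLIntegral_one]
            refine lintegral_congr_ae ((ae_restrict_of_ae hwpos).mono fun x hx => ?_)
            have : W x ≠ 0 := by simpa [hW] using hx
            beta_reduce
            rw [← ENNReal.rpow_add _ _ this ENNReal.ofReal_ne_top]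
            simp
        _ ≤ _ := by
            refine (ENNReal.lintegral_mul_le_Lp_mul_Lq _ hconj
              (hWm.restrict.pow_const _) (hWm.restrict.pow_const _)).trans ?_
            simp_rw [← ENNReal.rpow_mul]
            rw [one_div_mul_cancel hr0.ne', one_div_div,
              show -(1 / r) * (r / (r - 1)) = -(1 / (r - 1)) by field_simp]
            simp only [ENNReal.rpow_one]
            gcongr
            exact lintegral_mono_set hEQ
    have h2 := ENNReal.rpow_le_rpow h1 hr0.le
    rwa [ENNReal.mul_rpow_of_nonneg _ _ hr0.le, ← ENNReal.rpow_mul, ← ENNReal.rpow_mul,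
      one_div_mul_cancel hr0.ne', ENNReal.rpow_one, div_mul_cancel₀ _ hr0.ne'] at h2
  have hVE : V ^ r ≤ 2 ^ r * volume E ^ r := by
    rw [← ENNReal.mul_rpow_of_nonneg _ _ hr0.le]
    exact ENNReal.rpow_le_rpow hvol hr0.le
  have hVr0 : V ^ r ≠ 0 := (ENNReal.rpow_pos (pos_iff_ne_zero.2 hV0) hVt).ne'
  have hVrt : V ^ r ≠ ∞ := ENNReal.rpow_ne_top_of_nonneg hr0.le hVt
  rw [← ENNReal.mul_le_mul_iff_left hVr0 hVrt]
  calc (∫⁻ x in cube a l, W x) * V ^ r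
      ≤ (∫⁻ x in cube a l, W x) * (2 ^ r * ((∫⁻ x in E, W x) * σ ^ (r - 1))) := by
        gcongr; exact hVE.trans (by gcongr)
    _ = 2 ^ r * (∫⁻ x in E, W x) * ((∫⁻ x in cube a l, W x) * σ ^ (r - 1)) := by ring
    _ ≤ 2 ^ r * (∫⁻ x in E, W x) * (C * V ^ r) := by gcongr
    _ = _ := by
        rw [ENNReal.coe_mul, ENNReal.coe_rpow_of_nonneg _ hr0.le]
        push_cast
        ring

end Weights

section GridTree

variable {n : ℕ}

/-- The tree of cubes of side at most `2ᴺ` of a shifted dyadic grid. -/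
def gridTree (α : Fin n → Fin 2) (N : ℤ) (t : ℕ) : Rn n → (Fin n → ℤ) := gridIndex α (N - t)

/-- The parent map of `gridTree`. -/
def gridTreePar (α : Fin n → Fin 2) (N : ℤ) (t : ℕ) : (Fin n → ℤ) → (Fin n → ℤ) :=
  gridParent α (N - (t + 1 : ℕ))

/-- The closed cube of a cell of `gridTree`. -/
def treeCube (α : Fin n → Fin 2) (N : ℤ) (S : ℕ × (Fin n → ℤ)) : Set (Rn n) :=
  gridCube α (N - S.1) S.2

lemma gridTree_par (α : Fin n → Fin 2) (N : ℤ) (t : ℕ) (x : Rn n) :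
    gridTree α N t x = gridTreePar α N t (gridTree α N (t + 1) x) := by
  rw [gridTree, gridTreePar, gridTree, ← gridIndex_succ]
  congr 1
  push_cast; ring

lemma measurable_gridTree (α : Fin n → Fin 2) (N : ℤ) (t : ℕ) : Measurable (gridTree α N t) :=
  measurable_gridIndex α _

lemma measurableSet_gridTree_cell (α : Fin n → Fin 2) (N : ℤ) (S : ℕ × (Fin n → ℤ)) :
    MeasurableSet (cell (gridTree α N) S) := measurableSet_cell (measurable_gridTree α N) S

lemma restrict_cell (α : Fin n → Fin 2) (N : ℤ) (S : ℕ × (Fin n → ℤ)) :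
    (volume : Measure (Rn n)).restrict (cell (gridTree α N) S) =
      volume.restrict (treeCube α N S) := restrict_setOf_gridIndex α (N - S.1) S.2

lemma volume_cell (α : Fin n → Fin 2) (N : ℤ) (S : ℕ × (Fin n → ℤ)) :
    volume (cell (gridTree α N) S) = volume (treeCube α N S) :=
  volume_setOf_gridIndex α (N - S.1) S.2

lemma cell_subset_treeCube (α : Fin n → Fin 2) (N : ℤ) (S : ℕ × (Fin n → ℤ)) :
    cell (gridTree α N) S ⊆ treeCube α N S := setOf_gridIndex_subset α (N - S.1) S.2

lemma volume_treeCube (α : Fin n → Fin 2) (N : ℤ) (S : ℕ × (Fin n → ℤ)) :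
    volume (treeCube α N S) = ENNReal.ofReal (2 ^ (N - S.1)) ^ n := volume_cube _ _

lemma volume_treeCube_ne_zero (α : Fin n → Fin 2) (N : ℤ) (S : ℕ × (Fin n → ℤ)) :
    volume (treeCube α N S) ≠ 0 := volume_cube_ne_zero _ (by positivity)

lemma volume_treeCube_ne_top (α : Fin n → Fin 2) (N : ℤ) (S : ℕ × (Fin n → ℤ)) :
    volume (treeCube α N S) ≠ ∞ := volume_cube_ne_top _ _

lemma sum_setLIntegral_treeCube_le (α : Fin n → Fin 2) (N : ℤ) (S : ℕ × (Fin n → ℤ))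
    (T : Finset (ℕ × (Fin n → ℤ)))
    (hsub : ∀ C ∈ T, cell (gridTree α N) C ⊆ cell (gridTree α N) S)
    (hdisj : (T : Set (ℕ × (Fin n → ℤ))).PairwiseDisjoint (cell (gridTree α N)))
    (g : Rn n → ℝ≥0∞) :
    ∑ C ∈ T, ∫⁻ y in treeCube α N C, g y ≤ ∫⁻ y in treeCube α N S, g y := by
  simp_rw [← restrict_cell]
  rw [← lintegral_biUnion_finset hdisj fun C _ => measurableSet_gridTree_cell α N C]
  exact lintegral_mono_set (Set.iUnion₂_subset hsub)

end GridTree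

section Luxemburg

variable {n : ℕ}

lemma youngLog_div_le (ℓ : ℕ) {u A : ℝ} (hu : 0 ≤ u) (hA : 1 ≤ A) :
    youngLog ℓ (u / A) ≤ youngLog ℓ u / A := by
  have hA0 : 0 < A := by linarith
  have h1 : posLog (u / A) ≤ posLog u :=
    posLog_le_posLog (div_nonneg hu hA0.le) (div_le_self hu hA)
  have h2 : (0 : ℝ) ≤ posLog (u / A) := posLog_nonneg
  unfold youngLog
  rw [div_mul_eq_mul_div]
  gcongr

lemma le_youngLog (ℓ : ℕ) {u : ℝ} (hu : 0 ≤ u) : u ≤ youngLog ℓ u := by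
  have h2 : (1 : ℝ) ≤ (1 + posLog u) ^ ℓ := one_le_pow₀ (by linarith [posLog_nonneg (x := u)])
  exact le_mul_of_one_le_right hu h2

/-- Disjoint subcubes with large Luxemburg averages have small total measure. -/
lemma sum_volume_le_of_lt_luxAvg (α : Fin n → Fin 2) (N : ℤ) (ℓ : ℕ) (f : Rn n → ℝ) {A : ℝ}
    (hA : 1 ≤ A) (S : ℕ × (Fin n → ℤ)) (T : Finset (ℕ × (Fin n → ℤ)))
    (hsub : ∀ C ∈ T, cell (gridTree α N) C ⊆ cell (gridTree α N) S)
    (hdisj : (T : Set (ℕ × (Fin n → ℤ))).PairwiseDisjoint (cell (gridTree α N)))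
    (hT : ∀ C ∈ T, ENNReal.ofReal A * luxAvg (youngLog ℓ) f (treeCube α N S) <
      luxAvg (youngLog ℓ) f (treeCube α N C)) :
    ENNReal.ofReal A * ∑ C ∈ T, volume (treeCube α N C) ≤ volume (treeCube α N S) := by
  have hA0 : 0 < A := by linarith
  rcases T.eq_empty_or_nonempty with rfl | hne
  · simp
  have hex : ∀ C ∈ T, ∃ r : ℝ, 0 < r ∧
      ⨍⁻ y in treeCube α N S, ENNReal.ofReal (youngLog ℓ (|f y| / r)) ∂volume ≤ 1 ∧
      ENNReal.ofReal A * ENNReal.ofReal r < luxAvg (youngLog ℓ) f (treeCube α N C) := by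
    intro C hC
    have h := hT C hC
    rw [mul_comm, ← ENNReal.lt_div_iff_mul_lt (Or.inl (by simpa using hA0))
      (Or.inl ENNReal.ofReal_ne_top)] at h
    unfold luxAvg at h
    simp only [iInf_lt_iff] at h
    obtain ⟨r, hr, h1, h2⟩ := h
    refine ⟨r, hr, h1, ?_⟩
    rwa [ENNReal.lt_div_iff_mul_lt (Or.inl (by simpa using hA0))
      (Or.inl ENNReal.ofReal_ne_top), mul_comm] at h2
  choose! r hr hadm hlt using hex
  obtain ⟨D, hD, hmin⟩ := T.exists_min_image r hne
  have hV0 := volume_treeCube_ne_zero α N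
  have hVt := volume_treeCube_ne_top α N
  have hS : ∫⁻ y in treeCube α N S, ENNReal.ofReal (youngLog ℓ (|f y| / r D)) ≤
      volume (treeCube α N S) := by
    have := hadm D hD
    rw [setLAverage_eq, ENNReal.div_le_iff (hV0 S) (hVt S), one_mul] at this
    exact this
  have hC : ∀ C ∈ T, ENNReal.ofReal A * volume (treeCube α N C) ≤
      ∫⁻ y in treeCube α N C, ENNReal.ofReal (youngLog ℓ (|f y| / r D)) := by
    intro C hC
    have h1 : ¬ ⨍⁻ y in treeCube α N C,
        ENNReal.ofReal (youngLog ℓ (|f y| / (A * r D))) ∂volume ≤ 1 := by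
      intro hle
      have h2 : luxAvg (youngLog ℓ) f (treeCube α N C) ≤ ENNReal.ofReal (A * r D) :=
        iInf_le_of_le (A * r D) (iInf₂_le (mul_pos hA0 (hr D hD)) hle)
      rw [ENNReal.ofReal_mul hA0.le] at h2
      refine absurd (hlt C hC) (not_lt.2 (h2.trans ?_))
      gcongr
      exact hmin C hC
    rw [setLAverage_eq, not_le, ENNReal.lt_div_iff_mul_lt (Or.inl (hV0 C)) (Or.inl (hVt C)),
      one_mul] at h1
    calc ENNReal.ofReal A * volume (treeCube α N C)
        ≤ ENNReal.ofReal A * ∫⁻ y in treeCube α N C,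
            ENNReal.ofReal (youngLog ℓ (|f y| / (A * r D))) := by gcongr
      _ = ∫⁻ y in treeCube α N C, ENNReal.ofReal A *
            ENNReal.ofReal (youngLog ℓ (|f y| / (A * r D))) := by
          rw [lintegral_const_mul' _ _ ENNReal.ofReal_ne_top]
      _ ≤ _ := by
          refine lintegral_mono fun y => ?_
          rw [← ENNReal.ofReal_mul hA0.le]
          refine ENNReal.ofReal_le_ofReal ?_
          have := youngLog_div_le ℓ (div_nonneg (abs_nonneg (f y)) (hr D hD).le) hA
          rw [le_div_iff₀ hA0, div_div, mul_comm (r D) A] at this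
          linarith
  rw [Finset.mul_sum]
  exact (Finset.sum_le_sum hC).trans
    ((sum_setLIntegral_treeCube_le α N S T hsub hdisj _).trans hS)

lemma laverage_enorm_le_luxAvg (ℓ : ℕ) (f : Rn n → ℝ) (Q : Set (Rn n)) :
    ⨍⁻ y in Q, ‖f y‖ₑ ∂volume ≤ luxAvg (youngLog ℓ) f Q := by
  unfold luxAvg
  refine le_iInf fun r => le_iInf₂ fun hr hadm => ?_
  calc ⨍⁻ y in Q, ‖f y‖ₑ ∂volume
      ≤ ⨍⁻ y in Q, ENNReal.ofReal r * ENNReal.ofReal (youngLog ℓ (|f y| / r)) ∂volume := by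
        refine lintegral_mono fun y => ?_
        rw [← ENNReal.ofReal_mul hr.le, Real.enorm_eq_ofReal_abs]
        refine ENNReal.ofReal_le_ofReal ?_
        have := le_youngLog ℓ (div_nonneg (abs_nonneg (f y)) hr.le)
        rwa [div_le_iff₀' hr] at this
    _ = ENNReal.ofReal r * ⨍⁻ y in Q, ENNReal.ofReal (youngLog ℓ (|f y| / r)) ∂volume := by
        unfold laverage
        rw [lintegral_const_mul' _ _ ENNReal.ofReal_ne_top]
    _ ≤ ENNReal.ofReal r * 1 := by gcongr
    _ = _ := mul_one _

lemma mul_le_exp_add_youngLog {s t : ℝ} (hs : 0 ≤ s) : s * t ≤ exp t + youngLog 1 s := by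
  rcases eq_or_lt_of_le hs with rfl | hs0
  · simp [youngLog, (exp_pos t).le]
  have h1 : s * (1 + (t - log s)) ≤ exp t := by
    have h := add_one_le_exp (t - log s)
    rw [exp_sub, exp_log hs0, le_div_iff₀ hs0] at h
    linarith
  have h2 : log s ≤ posLog s := le_max_right _ _
  have h3 : s * log s ≤ s * posLog s := mul_le_mul_of_nonneg_left h2 hs
  simp only [youngLog, pow_one]
  nlinarith

end Luxemburg

section BMO

variable {n : ℕ}

lemma setLIntegral_sub_average_le {b : Rn n → ℝ} {K : ℝ≥0} (hK : bmoNorm b ≤ K) (a : Rn n)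
    {l : ℝ} (hl : 0 < l) :
    ∫⁻ y in cube a l, ‖b y - ⨍ z in cube a l, b z ∂volume‖ₑ ≤ K * volume (cube a l) := by
  have h : ⨍⁻ y in cube a l, ‖b y - ⨍ z in cube a l, b z ∂volume‖ₑ ∂volume ≤ K :=
    le_trans (le_iSup₂_of_le a l (le_iSup (fun _ : 0 < l => _) hl)) hK
  rwa [setLAverage_eq, ENNReal.div_le_iff (volume_cube_ne_zero a hl) (volume_cube_ne_top a l)] at h

lemma ofReal_abs_average_sub_mul_le {b : Rn n → ℝ} (hb : LocallyIntegrable b) (a : Rn n) {l : ℝ}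
    (hl : 0 < l) (c : ℝ) :
    ENNReal.ofReal |(⨍ z in cube a l, b z ∂volume) - c| * volume (cube a l) ≤
      ∫⁻ y in cube a l, ‖b y - c‖ₑ := by
  have hV0 := volume_cube_ne_zero a hl
  have hVt := volume_cube_ne_top a l
  have hint : IntegrableOn b (cube a l) := hb.integrableOn_isCompact (isCompact_cube a l)
  have e : (volume.real (cube a l)) * ((⨍ z in cube a l, b z ∂volume) - c) =
      ∫ y in cube a l, (b y - c) := by
    have : volume.real (cube a l) ≠ 0 := (ENNReal.toReal_pos hV0 hVt).ne'
    rw [integral_sub hint (integrableOn_const hVt), setAverage_eq, setIntegral_const, smul_eq_mul,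
      smul_eq_mul]
    field_simp
  calc ENNReal.ofReal |(⨍ z in cube a l, b z ∂volume) - c| * volume (cube a l)
      = ENNReal.ofReal |(volume.real (cube a l)) * ((⨍ z in cube a l, b z ∂volume) - c)| := by
        rw [abs_mul, ENNReal.ofReal_mul (abs_nonneg _), abs_of_nonneg measureReal_nonneg,
          measureReal_def, ENNReal.ofReal_toReal hVt, mul_comm]
    _ = ‖∫ y in cube a l, (b y - c)‖ₑ := by rw [e, Real.enorm_eq_ofReal_abs]
    _ ≤ _ := enorm_integral_le_lintegral_enorm _

/-- The average of `b` over a cube of the tree. -/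
def treeAvg (b : Rn n → ℝ) (α : Fin n → Fin 2) (N : ℤ) (S : ℕ × (Fin n → ℤ)) : ℝ :=
  ⨍ y in treeCube α N S, b y ∂volume

lemma sum_volume_le_of_lt_abs_treeAvg_sub {b : Rn n → ℝ} (hb : LocallyIntegrable b) {K : ℝ≥0}
    (hK : bmoNorm b ≤ K) (α : Fin n → Fin 2) (N : ℤ) {κ : ℝ}
    (S : ℕ × (Fin n → ℤ)) (T : Finset (ℕ × (Fin n → ℤ)))
    (hsub : ∀ C ∈ T, cell (gridTree α N) C ⊆ cell (gridTree α N) S)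
    (hdisj : (T : Set (ℕ × (Fin n → ℤ))).PairwiseDisjoint (cell (gridTree α N)))
    (hT : ∀ C ∈ T, κ < |treeAvg b α N C - treeAvg b α N S|) :
    ENNReal.ofReal κ * ∑ C ∈ T, volume (treeCube α N C) ≤ K * volume (treeCube α N S) := by
  rw [Finset.mul_sum]
  calc ∑ C ∈ T, ENNReal.ofReal κ * volume (treeCube α N C)
      ≤ ∑ C ∈ T, ∫⁻ y in treeCube α N C, ‖b y - treeAvg b α N S‖ₑ := by
        refine Finset.sum_le_sum fun C hC => le_trans ?_
          (ofReal_abs_average_sub_mul_le hb _ (by positivity) _)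
        gcongr
        · exact (hT C hC).le
        · exact le_rfl
    _ ≤ ∫⁻ y in treeCube α N S, ‖b y - treeAvg b α N S‖ₑ :=
        sum_setLIntegral_treeCube_le α N S T hsub hdisj _
    _ ≤ _ := setLIntegral_sub_average_le hK _ (by positivity)

lemma abs_treeAvg_succ_sub_le {b : Rn n → ℝ} (hb : LocallyIntegrable b) {K : ℝ≥0}
    (hK : bmoNorm b ≤ K) (α : Fin n → Fin 2) (N : ℤ) (t : ℕ) (x : Rn n) :
    |treeAvg b α N (t + 1, gridTree α N (t + 1) x) - treeAvg b α N (t, gridTree α N t x)| ≤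
      (2 : ℝ≥0) ^ n * K := by
  set C : ℕ × (Fin n → ℤ) := (t + 1, gridTree α N (t + 1) x)
  set S : ℕ × (Fin n → ℤ) := (t, gridTree α N t x)
  have hsub : cell (gridTree α N) C ⊆ cell (gridTree α N) S := by
    intro y hy
    exact level_eq_of_le (gridTree_par α N) (Nat.le_succ t) hy
  have h1 : ENNReal.ofReal |treeAvg b α N C - treeAvg b α N S| * volume (treeCube α N C) ≤
      K * volume (treeCube α N S) := by
    refine (ofReal_abs_average_sub_mul_le hb _ (by positivity) _).trans ?_
    refine le_trans ?_ (setLIntegral_sub_average_le hK _ (by positivity))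
    have := sum_setLIntegral_treeCube_le α N S {C} (by simpa using hsub) (by simp)
      (fun y => ‖b y - treeAvg b α N S‖ₑ)
    rw [Finset.sum_singleton] at this
    exact this
  have hvol : volume (treeCube α N S) = 2 ^ n * volume (treeCube α N C) := by
    rw [volume_treeCube, volume_treeCube, ← mul_pow]
    congr 1
    rw [show (2 : ℝ≥0∞) = ENNReal.ofReal 2 by simp, ← ENNReal.ofReal_mul zero_le_two]
    congr 1
    rw [← zpow_one_add₀ two_ne_zero]
    congr 1
    simp only [C, S]
    push_cast; ring
  rw [hvol, ← mul_assoc, ENNReal.mul_le_mul_iff_left (volume_treeCube_ne_zero α N C)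
    (volume_treeCube_ne_top α N C)] at h1
  have h2 : ENNReal.ofReal |treeAvg b α N C - treeAvg b α N S| ≤
      ENNReal.ofReal ((2 : ℝ≥0) ^ n * K : ℝ≥0) := by
    refine h1.trans (le_of_eq ?_)
    rw [ENNReal.ofReal_coe_nnreal]
    push_cast; ring
  have h3 := (ENNReal.ofReal_le_ofReal_iff (NNReal.coe_nonneg _)).1 h2
  simpa using h3

end BMO

section Stopping

variable {n m m' : ℕ}

/-- The stopping relation: some Luxemburg average grows by a factor, or some mean of a symbol
moves by more than a constant. -/
def stopRel (α : Fin n → Fin 2) (N : ℤ) (ℓ : ℕ) (f : Fin m → Rn n → ℝ) (b : Fin m' → Rn n → ℝ)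
    (K : ℝ≥0) (C S : ℕ × (Fin n → ℤ)) : Prop :=
  (∃ i, ENNReal.ofReal (4 * (m + 1)) * luxAvg (youngLog ℓ) (f i) (treeCube α N S) <
    luxAvg (youngLog ℓ) (f i) (treeCube α N C)) ∨
  ∃ j, 4 * (m' + 1) * (K + 1 : ℝ) < |treeAvg (b j) α N C - treeAvg (b j) α N S|

lemma two_mul_sum_volume_le_of_stopRel (α : Fin n → Fin 2) (N : ℤ) (ℓ : ℕ)
    (f : Fin m → Rn n → ℝ) {b : Fin m' → Rn n → ℝ} {K : ℝ≥0}
    (hb : ∀ j, LocallyIntegrable (b j)) (hK : ∀ j, bmoNorm (b j) ≤ K)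
    (S : ℕ × (Fin n → ℤ)) (T : Finset (ℕ × (Fin n → ℤ)))
    (hsub : ∀ C ∈ T, cell (gridTree α N) C ⊆ cell (gridTree α N) S)
    (hT : ∀ C ∈ T, stopRel α N ℓ f b K C S)
    (hdisj : (T : Set (ℕ × (Fin n → ℤ))).PairwiseDisjoint (cell (gridTree α N))) :
    2 * ∑ C ∈ T, volume (cell (gridTree α N) C) ≤ volume (cell (gridTree α N) S) := by
  classical
  simp_rw [volume_cell]
  set V := volume (treeCube α N S) with hV
  have hVt : V ≠ ∞ := volume_treeCube_ne_top α N S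
  let P : Fin m → Finset (ℕ × (Fin n → ℤ)) := fun i => T.filter fun C =>
    ENNReal.ofReal (4 * (m + 1)) * luxAvg (youngLog ℓ) (f i) (treeCube α N S) <
    luxAvg (youngLog ℓ) (f i) (treeCube α N C)
  let R : Fin m' → Finset (ℕ × (Fin n → ℤ)) := fun j => T.filter fun C =>
    4 * (m' + 1) * (K + 1 : ℝ) < |treeAvg (b j) α N C - treeAvg (b j) α N S|
  have hP : ∀ i, ∑ C ∈ P i, volume (treeCube α N C) ≤ V / ENNReal.ofReal (4 * (m + 1)) := by
    intro i
    rw [ENNReal.le_div_iff_mul_le (Or.inl (by simp; positivity)) (Or.inl ENNReal.ofReal_ne_top),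
      mul_comm]
    refine sum_volume_le_of_lt_luxAvg α N ℓ (f i) ?_ S (P i) (fun C hC => ?_)
      (hdisj.subset (Finset.coe_subset.2 (Finset.filter_subset _ _))) (fun C hC => (Finset.mem_filter.1 hC).2)
    · have : (0 : ℝ) ≤ m := Nat.cast_nonneg m
      linarith
    · exact hsub C (Finset.mem_filter.1 hC).1
  have hR : ∀ j, ∑ C ∈ R j, volume (treeCube α N C) ≤ V / ENNReal.ofReal (4 * (m' + 1)) := by
    intro j
    have h := sum_volume_le_of_lt_abs_treeAvg_sub (hb j) (hK j) α N S (R j)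
      (fun C hC => hsub C (Finset.mem_filter.1 hC).1) (hdisj.subset (Finset.coe_subset.2 (Finset.filter_subset _ _)))
      (fun C hC => (Finset.mem_filter.1 hC).2)
    rw [ENNReal.le_div_iff_mul_le (Or.inl (by simp; positivity)) (Or.inl ENNReal.ofReal_ne_top)]
    have h0 : (K + 1 : ℝ≥0∞) ≠ 0 := by simp
    have ht : (K + 1 : ℝ≥0∞) ≠ ∞ := by simp
    rw [← ENNReal.mul_le_mul_iff_right h0 ht]
    calc (K + 1 : ℝ≥0∞) * ((∑ C ∈ R j, volume (treeCube α N C)) * ENNReal.ofReal (4 * (m' + 1)))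
        = ENNReal.ofReal (4 * (m' + 1) * (K + 1 : ℝ)) * ∑ C ∈ R j, volume (treeCube α N C) := by
          rw [ENNReal.ofReal_mul (p := 4 * ((m' : ℝ) + 1)) (by positivity),
            ENNReal.ofReal_add (p := (K : ℝ)) K.coe_nonneg zero_le_one]
          simp only [ENNReal.ofReal_coe_nnreal, ENNReal.ofReal_one]
          ring
      _ ≤ K * V := h
      _ ≤ (K + 1) * V := by gcongr; exact le_self_add
  have hcov : ∑ C ∈ T, volume (treeCube α N C) ≤
      ∑ i, ∑ C ∈ P i, volume (treeCube α N C) + ∑ j, ∑ C ∈ R j, volume (treeCube α N C) := by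
    simp only [P, R, Finset.sum_filter]
    rw [Finset.sum_comm, Finset.sum_comm (s := Finset.univ (α := Fin m')),
      ← Finset.sum_add_distrib]
    refine Finset.sum_le_sum fun C hC => ?_
    rcases hT C hC with ⟨i, hi⟩ | ⟨j, hj⟩
    · refine le_trans ?_ le_self_add
      refine le_trans (le_of_eq ?_) (Finset.single_le_sum (fun _ _ => bot_le)
        (Finset.mem_univ i))
      rw [if_pos hi]
    · refine le_trans ?_ le_add_self
      refine le_trans (le_of_eq ?_) (Finset.single_le_sum (fun _ _ => bot_le)
        (Finset.mem_univ j))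
      rw [if_pos hj]
  have hquart : ∀ k : ℕ, ∑ _i : Fin k, V / ENNReal.ofReal (4 * (k + 1)) ≤ V / 4 := by
    intro k
    rw [Finset.sum_const, Finset.card_univ, Fintype.card_fin, nsmul_eq_mul,
      ENNReal.le_div_iff_mul_le (Or.inl (by simp)) (Or.inl (by simp))]
    have h0 : ENNReal.ofReal (4 * (k + 1)) ≠ 0 := by simp; positivity
    have e : ENNReal.ofReal (4 * (k + 1)) = 4 * (k + 1) := by
      rw [ENNReal.ofReal_mul (by norm_num), ENNReal.ofReal_add (by positivity) zero_le_one]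
      simp
    calc (k : ℝ≥0∞) * (V / ENNReal.ofReal (4 * (k + 1))) * 4
        = V / ENNReal.ofReal (4 * (k + 1)) * (4 * k) := by ring
      _ ≤ V / ENNReal.ofReal (4 * (k + 1)) * ENNReal.ofReal (4 * (k + 1)) := by
          gcongr; rw [e]; gcongr; exact le_self_add
      _ = V := ENNReal.div_mul_cancel h0 ENNReal.ofReal_ne_top
  calc 2 * ∑ C ∈ T, volume (treeCube α N C) ≤ 2 * (V / 4 + V / 4) := by
        gcongr
        refine hcov.trans (add_le_add ?_ ?_)
        · exact (Finset.sum_le_sum fun i _ => hP i).trans (hquart m)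
        · exact (Finset.sum_le_sum fun i _ => hR i).trans (hquart m')
    _ = V := by
        rw [← two_mul, ← mul_assoc, show (2 : ℝ≥0∞) * 2 = 4 by norm_num]
        exact ENNReal.mul_div_cancel (by simp) (by simp)

lemma volume_cell_le_two_mul_coreSet (α : Fin n → Fin 2) (N : ℤ) (ℓ : ℕ)
    (f : Fin m → Rn n → ℝ) {b : Fin m' → Rn n → ℝ} {K : ℝ≥0}
    (hb : ∀ j, LocallyIntegrable (b j)) (hK : ∀ j, bmoNorm (b j) ≤ K)
    (S : StopCell (gridTreePar α N) (stopRel α N ℓ f b K)) :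
    volume (cell (gridTree α N) S.1) ≤
      2 * volume (coreSet (gridTree α N) (gridTreePar α N) (stopRel α N ℓ f b K) S.1) := by
  refine measure_cell_le_two_mul_coreSet (gridTree_par α N) (fun S => ?_)
    (two_mul_sum_volume_le_of_stopRel α N ℓ f hb hK) S
  rw [volume_cell]; exact volume_treeCube_ne_top α N S

/-- The constant bounding the oscillation of a symbol per stopping cube. -/
def oscConst (n m' : ℕ) (K : ℝ≥0) : ℝ≥0 := 4 * (m' + 1) * (K + 1) + 2 ^ n * K

variable {α : Fin n → Fin 2} {N : ℤ} {ℓ : ℕ} {f : Fin m → Rn n → ℝ} {b : Fin m' → Rn n → ℝ}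
  {K : ℝ≥0}

lemma abs_treeAvg_sub_principalAt_le (j : Fin m') (t : ℕ) (x : Rn n) :
    |treeAvg (b j) α N (t, gridTree α N t x) - treeAvg (b j) α N
      (principalAt (gridTree α N) (gridTreePar α N) (stopRel α N ℓ f b K) t x)| ≤
      (4 * (m' + 1) * (K + 1) : ℝ≥0) := by
  rcases principalAt_eq_or_not_bad (gridTree_par α N) (bad := stopRel α N ℓ f b K) t x with h | h
  · rw [h, sub_self, abs_zero]; exact NNReal.coe_nonneg _
  · unfold stopRel at h
    push Not at h
    have := h.2 j
    push_cast
    exact this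

lemma enorm_treeAvg_sub_principalAt_le (hb : ∀ j, LocallyIntegrable (b j))
    (hK : ∀ j, bmoNorm (b j) ≤ K) (j : Fin m') {x : Rn n}
    (hx : Filter.Tendsto (fun t : ℕ => treeAvg (b j) α N (t, gridTree α N t x)) Filter.atTop
      (nhds (b j x))) (t : ℕ) :
    ‖b j x - treeAvg (b j) α N
      (principalAt (gridTree α N) (gridTreePar α N) (stopRel α N ℓ f b K) t x)‖ₑ ≤
      oscConst n m' K * stopCount (gridTree α N) (gridTreePar α N) (stopRel α N ℓ f b K)
        (principalAt (gridTree α N) (gridTreePar α N) (stopRel α N ℓ f b K) t x).1 x := by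
  set P := principalAt (gridTree α N) (gridTreePar α N) (stopRel α N ℓ f b K)
  have hspec := fun t => principalAt_spec (gridTree_par α N) (bad := stopRel α N ℓ f b K) t x
  have hP : ∀ t, P t x = ((P t x).1, gridTree α N (P t x).1 x) := fun t =>
    Prod.ext rfl (hspec t).2.1
  set β : ℕ → ℝ := fun t => treeAvg (b j) α N (t, gridTree α N t x) with hβ
  have hPβ : ∀ t, treeAvg (b j) α N (P t x) = β (P t x).1 := fun t => by
    conv_lhs => rw [hP t]
  have h1 : ∀ u, (P t x).1 ≤ u → ‖β u - β (P t x).1‖ₑ ≤ oscConst n m' K *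
      stopCount (gridTree α N) (gridTreePar α N) (stopRel α N ℓ f b K) (P t x).1 x := by
    intro u hu
    have := edist_le_stopCount (gridTree_par α N) (bad := stopRel α N ℓ f b K) β
      (κ := 4 * (m' + 1) * (K + 1)) (κ' := 2 ^ n * K) x (fun t => ?_) (fun t => ?_) (P t x).1 u
      ?_ hu
    · rw [Real.enorm_eq_ofReal_abs]
      refine this.trans (le_of_eq ?_)
      rw [oscConst, ENNReal.coe_add]
    · rw [← hPβ]; exact abs_treeAvg_sub_principalAt_le j t x
    · have := abs_treeAvg_succ_sub_le (hb j) (hK j) α N t x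
      push_cast at this ⊢
      exact this
    · exact (hspec t).2.2.trans (hP t)
  rw [hPβ]
  have h2 : Filter.Tendsto (fun u => ‖β u - β (P t x).1‖ₑ) Filter.atTop
      (nhds ‖b j x - β (P t x).1‖ₑ) := (hx.sub_const _).enorm
  exact le_of_tendsto h2 ((Filter.eventually_ge_atTop _).mono h1)

lemma ae_tendsto_treeAvg (hb : ∀ j, LocallyIntegrable (b j)) :
    ∀ᵐ x, ∀ j, Filter.Tendsto (fun t : ℕ => treeAvg (b j) α N (t, gridTree α N t x)) Filter.atTop
      (nhds (b j x)) :=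
  ae_all_iff.2 fun j => ae_tendsto_average_gridCube α N (hb j)

end Stopping

section JohnNirenberg

variable {n : ℕ}

lemma setLIntegral_stopCount_pow_le (α : Fin n → Fin 2) (N : ℤ) {b : Rn n → ℝ} {K : ℝ≥0}
    (hb : LocallyIntegrable b) (hK : bmoNorm b ≤ K) (z : Fin n → ℤ) (s : ℕ) :
    ∫⁻ x in cell (gridTree α N) (0, z), stopCount (gridTree α N) (gridTreePar α N)
      (stopRel α N 0 (fun _ : Fin 0 => 0) (fun _ : Fin 1 => b) K) 0 x ^ s ≤
      (2 * s) ^ s * volume (treeCube α N (0, z)) := by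
  classical
  rcases Nat.eq_zero_or_pos s with rfl | hs
  · simp [volume_cell]
  set bad := stopRel α N 0 (fun _ : Fin 0 => 0) (fun _ : Fin 1 => b) K
  set ζ := gridTree α N
  set par := gridTreePar α N
  set Q := cell ζ (0, z)
  let c : StopCell par bad → ℝ≥0∞ := fun S => if cell ζ S.1 ⊆ Q then 1 else 0
  have hs1 : (1 : ℝ) ≤ s := by exact_mod_cast hs
  have h := lintegral_tsum_indicator_rpow_le (μ := (volume : Measure (Rn n)))
    (fun S : StopCell par bad => S.1.1) (fun S => cell ζ S.1) (fun S => coreSet ζ par bad S.1)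
    (fun S => measurableSet_gridTree_cell α N S.1)
    (fun S => measurableSet_coreSet (measurable_gridTree α N) S.1)
    (fun S => coreSet_subset (gridTree_par α N) S.1)
    (fun S T hST => cell_nested (gridTree_par α N) S.1 T.1 hST) (C := 2)
    (fun S => volume_cell_le_two_mul_coreSet α N 0 _ (fun _ => hb) (fun _ => hK) S) c hs1
  have hQ : MeasurableSet Q := measurableSet_gridTree_cell α N (0, z)
  calc ∫⁻ x in Q, stopCount ζ par bad 0 x ^ s
      ≤ ∫⁻ x, (∑' S : StopCell par bad, (cell ζ S.1).indicator (fun _ => c S) x) ^ (s : ℝ) := by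
        rw [← lintegral_indicator hQ]
        refine lintegral_mono fun x => ?_
        by_cases hx : x ∈ Q
        · rw [Set.indicator_of_mem hx, ENNReal.rpow_natCast]
          gcongr
          refine (stopCount_le_tsum 0 x).trans (ENNReal.tsum_le_tsum fun S => ?_)
          rw [if_pos (Nat.zero_le _)]
          by_cases hxS : x ∈ cell ζ S.1
          · have hsub : cell ζ S.1 ⊆ Q := by
              rcases cell_nested (gridTree_par α N) (0, z) S.1 (Nat.zero_le _) with hd | hs
              · exact absurd hxS (Set.disjoint_left.1 hd hx)
              · exact hs
            simp [c, hsub]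
          · simp [hxS]
        · simp [hx]
    _ ≤ _ := h
    _ ≤ (2 * s) ^ s * volume (treeCube α N (0, z)) := by
        rw [ENNReal.rpow_natCast, ENNReal.ofReal_natCast, mul_comm (s : ℝ≥0∞)]
        push_cast
        gcongr
        rw [← volume_cell, ← lintegral_indicator_one hQ]
        refine lintegral_mono fun x => ?_
        have hle : ∑' S : StopCell par bad, (coreSet ζ par bad S.1).indicator (fun _ => c S) x ≤
            Q.indicator 1 x := by
          by_cases hex : ∃ S : StopCell par bad, x ∈ coreSet ζ par bad S.1
          · obtain ⟨S, hS⟩ := hex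
            rw [tsum_eq_single S]
            · rw [Set.indicator_of_mem hS]
              by_cases hsub : cell ζ S.1 ⊆ Q
              · have : x ∈ Q := hsub (coreSet_subset (gridTree_par α N) S.1 hS)
                simp [c, hsub, this]
              · simp [c, hsub]
            · intro T hT
              refine Set.indicator_of_notMem (fun hxT => ?_) _
              exact Set.disjoint_left.1 (coreSet_disjoint fun h => hT (Subtype.ext h)) hxT hS
          · push Not at hex
            rw [ENNReal.tsum_eq_zero.2 fun S => Set.indicator_of_notMem (hex S) _]
            exact bot_le
        refine (ENNReal.rpow_le_rpow hle (by linarith)).trans ?_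
        by_cases hx : x ∈ Q
        · simp [hx]
        · simp only [hx, not_false_eq_true, Set.indicator_of_notMem]
          rw [ENNReal.zero_rpow_of_pos (by linarith)]

/-- The John–Nirenberg inequality on the cubes of a shifted dyadic grid. -/
lemma setLIntegral_exp_sub_average_le (K : ℝ≥0) : ∃ c : ℝ, 0 < c ∧
    ∀ b : Rn n → ℝ, LocallyIntegrable b → bmoNorm b ≤ K →
    ∀ (α : Fin n → Fin 2) (k : ℤ) (z : Fin n → ℤ),
    ∫⁻ y in gridCube α k z,
      ENNReal.ofReal (exp (c * |b y - ⨍ u in gridCube α k z, b u ∂volume|)) ≤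
      2 * volume (gridCube α k z) := by
  set κ := oscConst n 1 K with hκ
  have hκ0 : 0 < κ := by
    rw [hκ, oscConst]; positivity
  have he : 0 < exp 1 := exp_pos 1
  set c : ℝ := 1 / (4 * exp 1 * κ) with hc
  have hκr : (0 : ℝ) < κ := hκ0
  have hc0 : 0 < c := by positivity
  refine ⟨c, hc0, fun b hb hK α k z => ?_⟩
  have hcube : treeCube α k (0, z) = gridCube α k z := by simp [treeCube]
  rw [← hcube]
  set a : ℝ := ⨍ u in treeCube α k (0, z), b u ∂volume with ha
  set cnt : Rn n → ℝ≥0∞ := stopCount (gridTree α k) (gridTreePar α k)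
      (stopRel α k 0 (fun _ : Fin 0 => 0) (fun _ : Fin 1 => b) K) 0
  have hosc : ∀ᵐ x ∂(volume.restrict (cell (gridTree α k) (0, z))), ‖b x - a‖ₑ ≤ κ * cnt x := by
    rw [ae_restrict_iff' (measurableSet_gridTree_cell α k (0, z))]
    filter_upwards [ae_tendsto_treeAvg (α := α) (N := k) (b := fun _ : Fin 1 => b)
      fun _ => hb] with x hx hxQ
    have := enorm_treeAvg_sub_principalAt_le (ℓ := 0) (f := fun _ : Fin 0 => 0) (K := K)
      (b := fun _ : Fin 1 => b) (fun _ => hb) (fun _ => hK) 0 (hx 0) 0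
    rw [principalAt_zero, show gridTree α k 0 x = z from hxQ] at this
    exact this
  have hexp : ∀ u : ℝ, 0 ≤ u → ENNReal.ofReal (exp (c * u)) =
      ∑' s : ℕ, ENNReal.ofReal (c ^ s / s.factorial) * ENNReal.ofReal u ^ s := by
    intro u hu
    have h1 : HasSum (fun s : ℕ => (c * u) ^ s / s.factorial) (exp (c * u)) := by
      rw [Real.exp_eq_exp_ℝ]
      exact NormedSpace.expSeries_div_hasSum_exp (c * u)
    rw [← h1.tsum_eq, ENNReal.ofReal_tsum_of_nonneg (fun s => by positivity) h1.summable]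
    refine tsum_congr fun s => ?_
    rw [← ENNReal.ofReal_pow hu, ← ENNReal.ofReal_mul (by positivity), mul_pow]
    congr 1; ring
  simp_rw [hexp _ (abs_nonneg _), ← Real.enorm_eq_ofReal_abs]
  have hbm : AEMeasurable (fun x => ‖b x - a‖ₑ) :=
    (hb.aestronglyMeasurable.sub aestronglyMeasurable_const).enorm
  rw [lintegral_tsum fun s => ((hbm.pow_const s).const_mul _).restrict]
  set V := volume (treeCube α k (0, z))
  have hterm : ∀ s : ℕ, ∫⁻ x in treeCube α k (0, z),
      ENNReal.ofReal (c ^ s / s.factorial) * ‖b x - a‖ₑ ^ s ≤ (1 / 2) ^ s * V := by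
    intro s
    rw [lintegral_const_mul' _ _ ENNReal.ofReal_ne_top, ← restrict_cell]
    calc ENNReal.ofReal (c ^ s / s.factorial) *
          ∫⁻ x in cell (gridTree α k) (0, z), ‖b x - a‖ₑ ^ s
        ≤ ENNReal.ofReal (c ^ s / s.factorial) *
          ∫⁻ x in cell (gridTree α k) (0, z), (κ : ℝ≥0∞) ^ s * cnt x ^ s := by
          gcongr 1
          refine lintegral_mono_ae (hosc.mono fun x hx => ?_)
          rw [← mul_pow]; gcongr
      _ ≤ ENNReal.ofReal (c ^ s / s.factorial) * ((κ : ℝ≥0∞) ^ s * ((2 * s) ^ s * V)) := by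
          rw [lintegral_const_mul' _ _ (ENNReal.pow_ne_top ENNReal.coe_ne_top)]
          gcongr
          exact setLIntegral_stopCount_pow_le α k hb hK z s
      _ = ENNReal.ofReal (c ^ s / s.factorial * (κ ^ s * (2 * s) ^ s)) * V := by
          rw [ENNReal.ofReal_mul (by positivity), ENNReal.ofReal_mul (by positivity),
            ENNReal.ofReal_pow κ.coe_nonneg, ENNReal.ofReal_pow (by positivity),
            ENNReal.ofReal_mul zero_le_two]
          simp only [ENNReal.ofReal_coe_nnreal, ENNReal.ofReal_natCast, ENNReal.ofReal_ofNat]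
          ring
      _ ≤ ENNReal.ofReal ((1 / 2) ^ s) * V := by
          gcongr
          have h1 := Real.pow_div_factorial_le_exp (s : ℝ) (Nat.cast_nonneg s) s
          have h2 : exp (s : ℝ) = exp 1 ^ s := by rw [← Real.exp_nat_mul, mul_one]
          calc c ^ s / s.factorial * ((κ : ℝ) ^ s * (2 * s) ^ s)
              = (2 * c * κ) ^ s * ((s : ℝ) ^ s / s.factorial) := by
                simp only [mul_pow]; ring
            _ ≤ (2 * c * κ) ^ s * exp 1 ^ s := by rw [← h2]; gcongr
            _ = (1 / 2) ^ s := by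
                rw [← mul_pow]; congr 1
                rw [hc]; field_simp; norm_num
      _ = _ := by
          rw [ENNReal.ofReal_pow (by norm_num), ENNReal.ofReal_div_of_pos two_pos]
          simp
  refine (ENNReal.tsum_le_tsum hterm).trans (le_of_eq ?_)
  rw [ENNReal.tsum_mul_right, one_div, ENNReal.tsum_geometric, ENNReal.one_sub_inv_two, inv_inv]

/-- Hölder's inequality between `exp L` and `L log L` for a symbol in `BMO`. -/
lemma exists_laverage_sub_mul_le_luxAvg (K : ℝ≥0) : ∃ C : ℝ≥0,
    ∀ b : Rn n → ℝ, LocallyIntegrable b → bmoNorm b ≤ K →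
    ∀ (f : Rn n → ℝ) (α : Fin n → Fin 2) (k : ℤ) (z : Fin n → ℤ),
    ∫⁻ y in gridCube α k z, ‖b y - ⨍ u in gridCube α k z, b u ∂volume‖ₑ * ‖f y‖ₑ ≤
      C * luxAvg (youngLog 1) f (gridCube α k z) * volume (gridCube α k z) := by
  obtain ⟨c, hc, hJN⟩ := setLIntegral_exp_sub_average_le (n := n) K
  refine ⟨(3 / c).toNNReal, fun b hb hK f α k z => ?_⟩
  set Q := gridCube α k z
  set a : ℝ := ⨍ u in Q, b u ∂volume
  have hV0 : volume Q ≠ 0 := volume_cube_ne_zero _ (by positivity)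
  have hVt : volume Q ≠ ∞ := volume_cube_ne_top _ _
  have hbm : AEMeasurable (fun x => ENNReal.ofReal (exp (c * |b x - a|))) (volume.restrict Q) := by
    have h1 : AEMeasurable (fun x => b x - a) :=
      (hb.aestronglyMeasurable.sub aestronglyMeasurable_const).aemeasurable
    exact ((measurable_exp.comp_aemeasurable ((continuous_abs.measurable.comp_aemeasurable
      h1).const_mul c)).ennreal_ofReal).restrict
  rw [← ENNReal.div_le_iff hV0 hVt, luxAvg, ENNReal.mul_iInf_of_ne
    (by simpa using by positivity) ENNReal.coe_ne_top]
  refine le_iInf fun r => ?_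
  rw [ENNReal.mul_iInf_of_ne (by simpa using by positivity) ENNReal.coe_ne_top]
  refine le_iInf fun hr => ?_
  rw [ENNReal.mul_iInf_of_ne (by simpa using by positivity) ENNReal.coe_ne_top]
  refine le_iInf fun hadm => ?_
  rw [ENNReal.div_le_iff hV0 hVt]
  rw [setLAverage_eq, ENNReal.div_le_iff hV0 hVt, one_mul] at hadm
  calc ∫⁻ y in Q, ‖b y - a‖ₑ * ‖f y‖ₑ
      ≤ ∫⁻ y in Q, ENNReal.ofReal (r / c) * (ENNReal.ofReal (exp (c * |b y - a|)) +
          ENNReal.ofReal (youngLog 1 (|f y| / r))) := by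
        refine lintegral_mono fun y => ?_
        have hy0 : 0 ≤ |f y| / r := by positivity
        have h1 := mul_le_exp_add_youngLog (s := |f y| / r) (t := c * |b y - a|) hy0
        have h2 := hy0.trans (le_youngLog 1 hy0)
        rw [Real.enorm_eq_ofReal_abs, Real.enorm_eq_ofReal_abs,
          ← ENNReal.ofReal_mul (abs_nonneg _), ← ENNReal.ofReal_add (exp_pos _).le h2,
          ← ENNReal.ofReal_mul (by positivity)]
        refine ENNReal.ofReal_le_ofReal ?_
        calc |b y - a| * |f y| = r / c * (|f y| / r * (c * |b y - a|)) := by field_simp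
          _ ≤ _ := by gcongr
    _ = ENNReal.ofReal (r / c) * ((∫⁻ y in Q, ENNReal.ofReal (exp (c * |b y - a|))) +
          ∫⁻ y in Q, ENNReal.ofReal (youngLog 1 (|f y| / r))) := by
        rw [lintegral_const_mul' _ _ ENNReal.ofReal_ne_top, lintegral_add_left' hbm]
    _ ≤ ENNReal.ofReal (r / c) * (2 * volume Q + volume Q) := by
        gcongr
        exact hJN b hb hK α k z
    _ = _ := by
        rw [show ((3 / c).toNNReal : ℝ≥0∞) = ENNReal.ofReal (3 / c) from rfl,
          ← ENNReal.ofReal_mul (by positivity), show 3 / c * r = r / c * 3 by ring,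
          ENNReal.ofReal_mul (by positivity)]
        simp only [ENNReal.ofReal_ofNat]
        ring

end JohnNirenberg

section Domination

variable {n m m' : ℕ}

lemma ennreal_tsum_rpow_le {ι : Type*} (u : ι → ℝ≥0∞) {θ : ℝ} (hθ : 0 < θ) (hθ1 : θ ≤ 1) :
    (∑' i, u i) ^ θ ≤ ∑' i, u i ^ θ := by
  classical
  have hfin : ∀ T : Finset ι, (∑ i ∈ T, u i) ^ θ ≤ ∑ i ∈ T, u i ^ θ := by
    intro T
    induction T using Finset.induction_on with
    | empty => simp [hθ]
    | insert a T ha ih =>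
      rw [Finset.sum_insert ha, Finset.sum_insert ha]
      exact (ENNReal.rpow_add_le_add_rpow _ _ hθ.le hθ1).trans (by gcongr)
  rw [ENNReal.tsum_eq_iSup_sum, ← ENNReal.orderIsoRpow_apply θ hθ, OrderIso.map_iSup]
  exact iSup_le fun T => (hfin T).trans (ENNReal.sum_le_tsum T)

/-- The product of Luxemburg averages over a cube of the tree. -/
def treeProd (α : Fin n → Fin 2) (N : ℤ) (ℓ : ℕ) (f : Fin m → Rn n → ℝ)
    (S : ℕ × (Fin n → ℤ)) : ℝ≥0∞ :=
  ∏ i, luxAvg (youngLog ℓ) (f i) (treeCube α N S)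

/-- Averages over the cube of side `2ᵏ` containing `x`, weighted by the local oscillation of the
symbols at `x`. -/
def gridTerm (α : Fin n → Fin 2) (ℓ : ℕ) (f : Fin m → Rn n → ℝ) (b : Fin m' → Rn n → ℝ) (k : ℤ)
    (x : Rn n) : ℝ≥0∞ :=
  (1 + ∑ j, ‖b j x - ⨍ y in gridCube α k (gridIndex α k x), b j y ∂volume‖ₑ) *
    ∏ i, luxAvg (youngLog ℓ) (f i) (gridCube α k (gridIndex α k x))

variable {α : Fin n → Fin 2} {N : ℤ} {ℓ : ℕ} {f : Fin m → Rn n → ℝ} {b : Fin m' → Rn n → ℝ}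
  {K : ℝ≥0}

/-- The constant in `gridTerm_le`. -/
def gridTermConst (n m m' : ℕ) (K : ℝ≥0) : ℝ≥0 :=
  (1 + m' * (2 * oscConst n m' K)) * (4 * (m + 1)) ^ m

lemma gridTerm_le (hb : ∀ j, LocallyIntegrable (b j)) (hK : ∀ j, bmoNorm (b j) ≤ K) {x : Rn n}
    (hx : ∀ j, Filter.Tendsto (fun t : ℕ => treeAvg (b j) α N (t, gridTree α N t x)) Filter.atTop
      (nhds (b j x))) (t : ℕ) :
    gridTerm α ℓ f b (N - t) x ≤ gridTermConst n m m' K *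
      (stopCount (gridTree α N) (gridTreePar α N) (stopRel α N ℓ f b K)
        (principalAt (gridTree α N) (gridTreePar α N) (stopRel α N ℓ f b K) t x).1 x *
      treeProd α N ℓ f (principalAt (gridTree α N) (gridTreePar α N) (stopRel α N ℓ f b K) t x)) := by
  set P := principalAt (gridTree α N) (gridTreePar α N) (stopRel α N ℓ f b K) t x with hP
  set c := stopCount (gridTree α N) (gridTreePar α N) (stopRel α N ℓ f b K) P.1 x
  have hc : 1 ≤ c := one_le_stopCount (gridTree_par α N) t x
  have h1 : ∀ j, ‖b j x - treeAvg (b j) α N (t, gridTree α N t x)‖ₑ ≤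
      2 * oscConst n m' K * c := by
    intro j
    have h2 := enorm_treeAvg_sub_principalAt_le (ℓ := ℓ) (f := f) hb hK j (hx j) t
    have h3 := abs_treeAvg_sub_principalAt_le (α := α) (N := N) (ℓ := ℓ) (f := f) (b := b) (K := K)
      j t x
    have h4 : ‖treeAvg (b j) α N P - treeAvg (b j) α N (t, gridTree α N t x)‖ₑ ≤
        oscConst n m' K * c := by
      rw [Real.enorm_eq_ofReal_abs, abs_sub_comm]
      calc _ ≤ ENNReal.ofReal ((4 * (m' + 1) * (K + 1) : ℝ≥0) : ℝ) :=
            ENNReal.ofReal_le_ofReal h3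
        _ ≤ oscConst n m' K * 1 := by
            rw [ENNReal.ofReal_coe_nnreal, mul_one]
            exact ENNReal.coe_le_coe.2 le_self_add
        _ ≤ _ := by gcongr
    calc ‖b j x - treeAvg (b j) α N (t, gridTree α N t x)‖ₑ
        = ‖(b j x - treeAvg (b j) α N P) +
            (treeAvg (b j) α N P - treeAvg (b j) α N (t, gridTree α N t x))‖ₑ := by
          congr 1; ring
      _ ≤ _ := enorm_add_le _ _
      _ ≤ oscConst n m' K * c + oscConst n m' K * c := add_le_add h2 h4
      _ = _ := by ring
  have h5 : 1 + ∑ j, ‖b j x - treeAvg (b j) α N (t, gridTree α N t x)‖ₑ ≤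
      (1 + m' * (2 * oscConst n m' K)) * c := by
    calc _ ≤ c + ∑ _j : Fin m', 2 * oscConst n m' K * c :=
          add_le_add hc (Finset.sum_le_sum fun j _ => h1 j)
      _ = _ := by
          rw [Finset.sum_const, Finset.card_univ, Fintype.card_fin, nsmul_eq_mul]; ring
  have h6 : treeProd α N ℓ f (t, gridTree α N t x) ≤ (4 * (m + 1)) ^ m * treeProd α N ℓ f P := by
    have e : ENNReal.ofReal (4 * (m + 1)) = 4 * (m + 1) := by
      rw [ENNReal.ofReal_mul (by norm_num), ENNReal.ofReal_add (by positivity) zero_le_one]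
      simp
    have h7 : ∀ i, luxAvg (youngLog ℓ) (f i) (treeCube α N (t, gridTree α N t x)) ≤
        4 * (m + 1) * luxAvg (youngLog ℓ) (f i) (treeCube α N P) := by
      intro i
      rcases principalAt_eq_or_not_bad (gridTree_par α N) (bad := stopRel α N ℓ f b K) t x
        with h | h
      · rw [hP, h, ← e]
        refine le_mul_of_one_le_left bot_le ?_
        rw [ENNReal.one_le_ofReal]
        have : (0 : ℝ) ≤ m := Nat.cast_nonneg m
        linarith
      · unfold stopRel at h
        push Not at h
        rw [← e]
        exact h.1 i
    calc _ ≤ ∏ i : Fin m, 4 * ((m : ℝ≥0∞) + 1) * luxAvg (youngLog ℓ) (f i) (treeCube α N P) :=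
          Finset.prod_le_prod' fun i _ => h7 i
      _ = _ := by
          rw [Finset.prod_mul_distrib, Finset.prod_const, Finset.card_univ, Fintype.card_fin,
            treeProd]
  calc gridTerm α ℓ f b (N - t) x
      = (1 + ∑ j, ‖b j x - treeAvg (b j) α N (t, gridTree α N t x)‖ₑ) *
          treeProd α N ℓ f (t, gridTree α N t x) := rfl
    _ ≤ ((1 + m' * (2 * oscConst n m' K)) * c) * ((4 * (m + 1)) ^ m * treeProd α N ℓ f P) := by
        gcongr
    _ = _ := by
        rw [gridTermConst]; push_cast; ring

/-- The coefficient of a stopping cube. -/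
def stopCoeff (Ψ : ℝ → ℝ≥0∞) (θ : ℝ) (α : Fin n → Fin 2) (N : ℤ) (ℓ : ℕ) (f : Fin m → Rn n → ℝ)
    (S : ℕ × (Fin n → ℤ)) : ℝ≥0∞ :=
  (Ψ (2 ^ (N - S.1)) * treeProd α N ℓ f S) ^ θ

open Classical in
/-- The sum of the coefficients of all stopping cubes containing a given one. -/
def stopCoeffSum (Ψ : ℝ → ℝ≥0∞) (θ : ℝ) (α : Fin n → Fin 2) (N : ℤ) (ℓ : ℕ)
    (f : Fin m → Rn n → ℝ) (b : Fin m' → Rn n → ℝ) (K : ℝ≥0)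
    (S' : StopCell (gridTreePar α N) (stopRel α N ℓ f b K)) : ℝ≥0∞ :=
  ∑' S : StopCell (gridTreePar α N) (stopRel α N ℓ f b K),
    if S.1.1 ≤ S'.1.1 ∧ cell (gridTree α N) S'.1 ⊆ cell (gridTree α N) S.1 then
      stopCoeff Ψ θ α N ℓ f S.1 else 0

/-- Pointwise domination by a sum over stopping cubes. -/
lemma tsum_gridTerm_rpow_le {θ : ℝ} (hθ : 0 < θ) (hθ1 : θ ≤ 1) {a : ℤ → ℝ≥0∞} {Ψ : ℝ → ℝ≥0∞}
    (hΨ : ∀ (N : ℤ) (u : ℕ), ∑' t : ℕ, (if u ≤ t then a (N - t) ^ θ else 0) ≤ Ψ (2 ^ (N - u)) ^ θ)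
    (hb : ∀ j, LocallyIntegrable (b j)) (hK : ∀ j, bmoNorm (b j) ≤ K) {x : Rn n}
    (hx : ∀ j, Filter.Tendsto (fun t : ℕ => treeAvg (b j) α N (t, gridTree α N t x)) Filter.atTop
      (nhds (b j x))) :
    (∑' t : ℕ, a (N - t) * gridTerm α ℓ f b (N - t) x) ^ θ ≤
      gridTermConst n m m' K ^ θ *
        ∑' S : StopCell (gridTreePar α N) (stopRel α N ℓ f b K),
          (cell (gridTree α N) S.1).indicator (fun _ => stopCoeffSum Ψ θ α N ℓ f b K S) x := by
  classical
  set bad := stopRel α N ℓ f b K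
  set ζ := gridTree α N
  set par := gridTreePar α N
  set D : ℝ≥0∞ := ((gridTermConst n m m' K : ℝ≥0) : ℝ≥0∞)
  have hspec := fun t => principalAt_spec (gridTree_par α N) (bad := bad) t x
  have hmem : ∀ t, x ∈ cell ζ (principalAt ζ par bad t x) := fun t => (hspec t).2.1.symm
  have hprin : ∀ t, principal par bad (principalAt ζ par bad t x).1 (principalAt ζ par bad t x).2 =
      principalAt ζ par bad t x := fun t => by
    have := (hspec t).2.2
    rw [principalAt, ← (hspec t).2.1] at this
    exact this
  let g : ℕ → StopCell par bad → ℝ≥0∞ := fun t S =>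
    (cell ζ S.1).indicator (fun _ => stopCount ζ par bad S.1.1 x * treeProd α N ℓ f S.1 ^ θ) x *
      (if S.1.1 ≤ t then a (N - t) ^ θ else 0)
  have hterm : ∀ t : ℕ, (a (N - t) * gridTerm α ℓ f b (N - t) x) ^ θ ≤ D ^ θ * ∑' S, g t S := by
    intro t
    refine le_trans ?_ (mul_le_mul_right (ENNReal.le_tsum ⟨_, hprin t⟩) _)
    have hN : 1 ≤ stopCount ζ par bad (principalAt ζ par bad t x).1 x :=
      one_le_stopCount (gridTree_par α N) t x
    simp only [g]
    rw [Set.indicator_of_mem (hmem t), if_pos (hspec t).1]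
    have h1 := gridTerm_le (ℓ := ℓ) (f := f) hb hK hx t
    calc (a (N - t) * gridTerm α ℓ f b (N - t) x) ^ θ
        ≤ (a (N - t) * (D * (stopCount ζ par bad (principalAt ζ par bad t x).1 x *
            treeProd α N ℓ f (principalAt ζ par bad t x)))) ^ θ := by gcongr
      _ = D ^ θ * (stopCount ζ par bad (principalAt ζ par bad t x).1 x ^ θ *
            treeProd α N ℓ f (principalAt ζ par bad t x) ^ θ * a (N - t) ^ θ) := by
          simp only [ENNReal.mul_rpow_of_nonneg _ _ hθ.le]
          ring
      _ ≤ _ := by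
          gcongr
          calc _ ≤ stopCount ζ par bad (principalAt ζ par bad t x).1 x ^ (1 : ℝ) :=
                ENNReal.rpow_le_rpow_of_exponent_le hN hθ1
            _ = _ := ENNReal.rpow_one _
  refine (ennreal_tsum_rpow_le _ hθ hθ1).trans ((ENNReal.tsum_le_tsum hterm).trans ?_)
  rw [ENNReal.tsum_mul_left]
  refine mul_le_mul_right ?_ _
  rw [ENNReal.tsum_comm]
  calc ∑' S : StopCell par bad, ∑' t, g t S
      ≤ ∑' S : StopCell par bad, (cell ζ S.1).indicator
          (fun _ => stopCoeff Ψ θ α N ℓ f S.1) x * stopCount ζ par bad S.1.1 x := by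
        refine ENNReal.tsum_le_tsum fun S => ?_
        simp only [g]
        rw [ENNReal.tsum_mul_left]
        by_cases hS : x ∈ cell ζ S.1
        · rw [Set.indicator_of_mem hS, Set.indicator_of_mem hS, stopCoeff,
            ENNReal.mul_rpow_of_nonneg _ _ hθ.le]
          calc _ ≤ stopCount ζ par bad S.1.1 x * treeProd α N ℓ f S.1 ^ θ *
                Ψ (2 ^ (N - S.1.1)) ^ θ := by gcongr; exact hΨ N S.1.1
            _ = _ := by ring
        · simp [hS]
    _ ≤ ∑' S : StopCell par bad, (cell ζ S.1).indicator
          (fun _ => stopCoeff Ψ θ α N ℓ f S.1) x * ∑' S' : StopCell par bad,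
            if S.1.1 ≤ S'.1.1 then (cell ζ S'.1).indicator (fun _ => 1) x else 0 := by
        gcongr with S
        exact stopCount_le_tsum S.1.1 x
    _ = ∑' S' : StopCell par bad, ∑' S : StopCell par bad, (cell ζ S.1).indicator
          (fun _ => stopCoeff Ψ θ α N ℓ f S.1) x *
            if S.1.1 ≤ S'.1.1 then (cell ζ S'.1).indicator (fun _ => 1) x else 0 := by
        simp_rw [← ENNReal.tsum_mul_left]
        rw [ENNReal.tsum_comm]
    _ ≤ _ := by
        refine ENNReal.tsum_le_tsum fun S' => ?_
        by_cases hS' : x ∈ cell ζ S'.1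
        · simp only [Set.indicator_of_mem hS', stopCoeffSum]
          refine ENNReal.tsum_le_tsum fun S => ?_
          by_cases hS : x ∈ cell ζ S.1
          · by_cases hle : S.1.1 ≤ S'.1.1
            · have hsub : cell ζ S'.1 ⊆ cell ζ S.1 := by
                rcases cell_nested (gridTree_par α N) S.1 S'.1 hle with hd | hs
                · exact absurd hS' (Set.disjoint_left.1 hd hS)
                · exact hs
              rw [if_pos hle, if_pos (And.intro hle hsub), Set.indicator_of_mem hS, mul_one]
            · simp [hle]
          · simp [hS]
        · simp [hS']

/-- The cores of the stopping cubes carry the maximal function. -/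
lemma tsum_indicator_coreSet_le_maximal (Ψ : ℝ → ℝ≥0∞) {θ : ℝ} (hθ : 0 < θ) (x : Rn n) :
    ∑' S : StopCell (gridTreePar α N) (stopRel α N ℓ f b K),
      (coreSet (gridTree α N) (gridTreePar α N) (stopRel α N ℓ f b K) S.1).indicator
        (fun _ => stopCoeff Ψ θ α N ℓ f S.1) x ≤ maximal Ψ (youngLog ℓ) f x ^ θ := by
  by_cases hex : ∃ S : StopCell (gridTreePar α N) (stopRel α N ℓ f b K),
      x ∈ coreSet (gridTree α N) (gridTreePar α N) (stopRel α N ℓ f b K) S.1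
  · obtain ⟨S, hS⟩ := hex
    rw [tsum_eq_single S]
    · rw [Set.indicator_of_mem hS, stopCoeff]
      refine ENNReal.rpow_le_rpow ?_ hθ.le
      have hxS := cell_subset_treeCube α N S.1 (coreSet_subset (gridTree_par α N) S.1 hS)
      refine le_iSup₂_of_le (gridCorner α (N - S.1.1) S.1.2) (2 ^ (N - S.1.1)) ?_
      exact le_iSup₂ (f := fun (_ : (0 : ℝ) < 2 ^ (N - S.1.1)) (_ : x ∈ cube _ _) => _)
        (by positivity) hxS
    · intro T hT
      refine Set.indicator_of_notMem (fun hxT => ?_) _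
      exact Set.disjoint_left.1 (coreSet_disjoint fun h => hT (Subtype.ext h)) hxT hS
  · push Not at hex
    rw [ENNReal.tsum_eq_zero.2 fun S => Set.indicator_of_notMem (hex S) _]
    exact bot_le

lemma tsum_indicator_coreSet_stopCoeffSum_le (Ψ : ℝ → ℝ≥0∞) (θ : ℝ) (x : Rn n) :
    ∑' S : StopCell (gridTreePar α N) (stopRel α N ℓ f b K),
      (coreSet (gridTree α N) (gridTreePar α N) (stopRel α N ℓ f b K) S.1).indicator
        (fun _ => stopCoeffSum Ψ θ α N ℓ f b K S) x ≤
    ∑' S : StopCell (gridTreePar α N) (stopRel α N ℓ f b K),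
      (cell (gridTree α N) S.1).indicator (fun _ => stopCoeff Ψ θ α N ℓ f S.1) x := by
  classical
  by_cases hex : ∃ S : StopCell (gridTreePar α N) (stopRel α N ℓ f b K),
      x ∈ coreSet (gridTree α N) (gridTreePar α N) (stopRel α N ℓ f b K) S.1
  · obtain ⟨S, hS⟩ := hex
    rw [tsum_eq_single S]
    · rw [Set.indicator_of_mem hS, stopCoeffSum]
      refine ENNReal.tsum_le_tsum fun T => ?_
      split_ifs with h
      · rw [Set.indicator_of_mem (h.2 (coreSet_subset (gridTree_par α N) S.1 hS))]
      · exact bot_le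
    · intro T hT
      refine Set.indicator_of_notMem (fun hxT => ?_) _
      exact Set.disjoint_left.1 (coreSet_disjoint fun h => hT (Subtype.ext h)) hxT hS
  · push Not at hex
    rw [ENNReal.tsum_eq_zero.2 fun S => Set.indicator_of_notMem (hex S) _]
    exact bot_le

/-- The weighted estimate for the part of the sum over cubes of side at most `2ᴺ`. -/
lemma exists_lintegral_tsum_gridTerm_le (n m m' : ℕ) {w : Rn n → ℝ} (hw : MemAInfty w) (K : ℝ≥0)
    {θ p : ℝ} (hθ : 0 < θ) (hθ1 : θ ≤ 1) (hp : θ ≤ p) : ∃ C : ℝ≥0,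
    ∀ (a : ℤ → ℝ≥0∞) (Ψ : ℝ → ℝ≥0∞), (∀ (N : ℤ) (u : ℕ),
      ∑' t : ℕ, (if u ≤ t then a (N - t) ^ θ else 0) ≤ Ψ (2 ^ (N - u)) ^ θ) →
    ∀ (α : Fin n → Fin 2) (ℓ : ℕ) (f : Fin m → Rn n → ℝ) (b : Fin m' → Rn n → ℝ),
      (∀ j, LocallyIntegrable (b j)) → (∀ j, bmoNorm (b j) ≤ K) → ∀ N : ℤ,
    ∫⁻ x, (∑' t : ℕ, a (N - t) * gridTerm α ℓ f b (N - t) x) ^ p * ENNReal.ofReal (w x) ≤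
      C * ∫⁻ x, maximal Ψ (youngLog ℓ) f x ^ p * ENNReal.ofReal (w x) := by
  obtain ⟨A, hA⟩ := exists_withDensity_cube_le hw
  have hwm : AEMeasurable fun x => ENNReal.ofReal (w x) := by
    obtain ⟨r, -, h, -⟩ := hw
    exact h.locallyIntegrable.aestronglyMeasurable.aemeasurable.ennreal_ofReal
  have hp0 : 0 < p := hθ.trans_le hp
  set s : ℝ := p / θ with hs
  have hs1 : 1 ≤ s := (one_le_div hθ).2 hp
  have hs0 : 0 < s := by linarith
  have hθs : θ * s = p := by rw [hs]; field_simp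
  set B : ℝ≥0 := (s.toNNReal * A) ^ s with hB
  refine ⟨gridTermConst n m m' K ^ p * (B * B), fun a Ψ hΨ α ℓ f b hb hK N => ?_⟩
  set bad := stopRel α N ℓ f b K
  set ζ := gridTree α N
  set par := gridTreePar α N
  set μ := (volume : Measure (Rn n)).withDensity fun x => ENNReal.ofReal (w x) with hμ
  have hcore : ∀ S : StopCell par bad, μ (cell ζ S.1) ≤ A * μ (coreSet ζ par bad S.1) := by
    intro S
    refine (measure_mono (cell_subset_treeCube α N S.1)).trans (hA _ _ (by positivity) _ ?_ ?_ ?_)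
    · exact (coreSet_subset (gridTree_par α N) S.1).trans (cell_subset_treeCube α N S.1)
    · exact measurableSet_coreSet (measurable_gridTree α N) S.1
    · have := volume_cell_le_two_mul_coreSet α N ℓ f hb hK S
      rw [volume_cell] at this
      exact this
  have hsparse : ∀ c : StopCell par bad → ℝ≥0∞,
      ∫⁻ x, (∑' S, (cell ζ S.1).indicator (fun _ => c S) x) ^ s ∂μ ≤
        B * ∫⁻ x, (∑' S, (coreSet ζ par bad S.1).indicator (fun _ => c S) x) ^ s ∂μ := by
    intro c
    have h := lintegral_tsum_indicator_rpow_le (μ := μ)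
      (fun S : StopCell par bad => S.1.1) (fun S => cell ζ S.1) (fun S => coreSet ζ par bad S.1)
      (fun S => measurableSet_gridTree_cell α N S.1)
      (fun S => measurableSet_coreSet (measurable_gridTree α N) S.1)
      (fun S => coreSet_subset (gridTree_par α N) S.1)
      (fun S T hST => cell_nested (gridTree_par α N) S.1 T.1 hST) hcore c hs1
    refine h.trans (le_of_eq ?_)
    rw [hB, ENNReal.coe_rpow_of_nonneg _ hs0.le]
    rfl
  have hmeas : ∀ (E : StopCell par bad → Set (Rn n)), (∀ S, MeasurableSet (E S)) →
      ∀ c : StopCell par bad → ℝ≥0∞,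
      Measurable fun x => (∑' S, (E S).indicator (fun _ => c S) x) ^ s := fun E hE c =>
    (Measurable.tsum fun S => measurable_const.indicator (hE S)).pow_const s
  have hconv : ∀ g : Rn n → ℝ≥0∞, Measurable g →
      ∫⁻ x, g x * ENNReal.ofReal (w x) = ∫⁻ x, g x ∂μ := by
    intro g hg
    rw [hμ, lintegral_withDensity_eq_lintegral_mul₀ hwm hg.aemeasurable]
    simp_rw [Pi.mul_apply, mul_comm]
  set D : ℝ≥0∞ := ((gridTermConst n m m' K : ℝ≥0) : ℝ≥0∞)
  have hDt : D ^ p ≠ ∞ := ENNReal.rpow_ne_top_of_nonneg hp0.le ENNReal.coe_ne_top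
  calc ∫⁻ x, (∑' t : ℕ, a (N - t) * gridTerm α ℓ f b (N - t) x) ^ p * ENNReal.ofReal (w x)
      ≤ ∫⁻ x, D ^ p * ((∑' S : StopCell par bad,
          (cell ζ S.1).indicator (fun _ => stopCoeffSum Ψ θ α N ℓ f b K S) x) ^ s *
            ENNReal.ofReal (w x)) := by
        refine lintegral_mono_ae ((ae_tendsto_treeAvg (α := α) (N := N) hb).mono fun x hx => ?_)
        have h1 := ENNReal.rpow_le_rpow
          (tsum_gridTerm_rpow_le (ℓ := ℓ) (f := f) hθ hθ1 hΨ hb hK hx) hs0.le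
        rw [← ENNReal.rpow_mul, hθs, ENNReal.mul_rpow_of_nonneg _ _ hs0.le, ← ENNReal.rpow_mul,
          hθs] at h1
        rw [← mul_assoc]
        gcongr
    _ = D ^ p * ∫⁻ x, (∑' S : StopCell par bad,
          (cell ζ S.1).indicator (fun _ => stopCoeffSum Ψ θ α N ℓ f b K S) x) ^ s ∂μ := by
        rw [lintegral_const_mul' _ _ hDt, hconv _
          (hmeas _ (fun S => measurableSet_gridTree_cell α N S.1) _)]
    _ ≤ D ^ p * (B * ∫⁻ x, (∑' S : StopCell par bad,
          (cell ζ S.1).indicator (fun _ => stopCoeff Ψ θ α N ℓ f S.1) x) ^ s ∂μ) := by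
        gcongr 1
        refine (hsparse _).trans ?_
        exact mul_le_mul_right (lintegral_mono fun x => ENNReal.rpow_le_rpow
          (tsum_indicator_coreSet_stopCoeffSum_le Ψ θ x) hs0.le) _
    _ ≤ D ^ p * (B * (B * ∫⁻ x, maximal Ψ (youngLog ℓ) f x ^ p * ENNReal.ofReal (w x))) := by
        gcongr 2
        refine (hsparse _).trans ?_
        gcongr 1
        rw [← hconv _ (hmeas _
          (fun S => measurableSet_coreSet (measurable_gridTree α N) S.1) _)]
        gcongr with x
        rw [← hθs, ENNReal.rpow_mul]
        exact ENNReal.rpow_le_rpow (tsum_indicator_coreSet_le_maximal Ψ hθ x) hs0.le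
    _ = _ := by
        rw [ENNReal.coe_mul, ENNReal.coe_mul, ENNReal.coe_rpow_of_nonneg _ hp0.le]
        ring

lemma aemeasurable_gridTerm (α : Fin n → Fin 2) (ℓ : ℕ) (f : Fin m → Rn n → ℝ)
    {b : Fin m' → Rn n → ℝ} (hb : ∀ j, LocallyIntegrable (b j)) (k : ℤ) :
    AEMeasurable (gridTerm α ℓ f b k) := by
  have hidx := measurable_gridIndex (n := n) α k
  refine AEMeasurable.mul ?_ ?_
  · refine AEMeasurable.const_add (Finset.aemeasurable_fun_sum _ fun j _ => ?_) 1
    refine AEMeasurable.enorm (AEMeasurable.sub (hb j).aestronglyMeasurable.aemeasurable ?_)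
    exact ((measurable_of_countable fun z => ⨍ y in gridCube α k z, b j y ∂volume).comp
      hidx).aemeasurable
  · exact ((measurable_of_countable fun z => ∏ i, luxAvg (youngLog ℓ) (f i)
      (gridCube α k z)).comp hidx).aemeasurable

/-- The weighted estimate for the sum over all cubes of a shifted dyadic grid. -/
lemma exists_lintegral_tsum_int_gridTerm_le (n m m' : ℕ) {w : Rn n → ℝ} (hw : MemAInfty w)
    (K : ℝ≥0) {θ p : ℝ} (hθ : 0 < θ) (hθ1 : θ ≤ 1) (hp : θ ≤ p) : ∃ C : ℝ≥0,
    ∀ (a : ℤ → ℝ≥0∞) (Ψ : ℝ → ℝ≥0∞), (∀ (N : ℤ) (u : ℕ),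
      ∑' t : ℕ, (if u ≤ t then a (N - t) ^ θ else 0) ≤ Ψ (2 ^ (N - u)) ^ θ) →
    ∀ (α : Fin n → Fin 2) (ℓ : ℕ) (f : Fin m → Rn n → ℝ) (b : Fin m' → Rn n → ℝ),
      (∀ j, LocallyIntegrable (b j)) → (∀ j, bmoNorm (b j) ≤ K) →
    ∫⁻ x, (∑' k : ℤ, a k * gridTerm α ℓ f b k x) ^ p * ENNReal.ofReal (w x) ≤
      C * ∫⁻ x, maximal Ψ (youngLog ℓ) f x ^ p * ENNReal.ofReal (w x) := by
  obtain ⟨C, hC⟩ := exists_lintegral_tsum_gridTerm_le n m m' hw K hθ hθ1 hp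
  have hwm : AEMeasurable fun x => ENNReal.ofReal (w x) := by
    obtain ⟨r, -, h, -⟩ := hw
    exact h.locallyIntegrable.aestronglyMeasurable.aemeasurable.ennreal_ofReal
  have hp0 : 0 < p := hθ.trans_le hp
  refine ⟨C, fun a Ψ hΨ α ℓ f b hb hK => ?_⟩
  let h : ℕ → Rn n → ℝ≥0∞ := fun N x =>
    ∑' k : ℤ, if k ≤ N then a k * gridTerm α ℓ f b k x else 0
  have hmono : ∀ x, Monotone fun N => h N x := by
    intro x N M hNM
    refine ENNReal.tsum_le_tsum fun k => ?_
    by_cases hk : k ≤ N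
    · rw [if_pos hk, if_pos (hk.trans (by exact_mod_cast hNM))]
    · rw [if_neg hk]; exact bot_le
  have hsup : ∀ x, ∑' k : ℤ, a k * gridTerm α ℓ f b k x = ⨆ N, h N x := by
    intro x
    refine le_antisymm ?_ (iSup_le fun N => ENNReal.tsum_le_tsum fun k => ?_)
    · rw [ENNReal.tsum_eq_iSup_sum]
      refine iSup_le fun T => ?_
      obtain ⟨M, hM⟩ := T.bddAbove
      refine le_iSup_of_le M.toNat ((Finset.sum_le_sum fun k hk => ?_).trans
        (ENNReal.sum_le_tsum T))
      rw [if_pos ((hM hk).trans (Int.self_le_toNat M))]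
    · split_ifs
      · exact le_rfl
      · exact bot_le
  have e : ∀ x, (∑' k : ℤ, a k * gridTerm α ℓ f b k x) ^ p * ENNReal.ofReal (w x) =
      ⨆ N, h N x ^ p * ENNReal.ofReal (w x) := by
    intro x
    rw [hsup, ← ENNReal.orderIsoRpow_apply p hp0, OrderIso.map_iSup, ENNReal.iSup_mul]
    rfl
  simp_rw [e]
  rw [lintegral_iSup']
  · refine iSup_le fun N => le_trans ?_ (hC a Ψ hΨ α ℓ f b hb hK N)
    gcongr with x
    let g : ℕ → ℝ≥0∞ := fun t => a (N - t) * gridTerm α ℓ f b (N - t) x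
    have hinj : Function.Injective fun k : {k : ℤ // k ≤ N} => (N - k.1).toNat := by
      intro k l hkl
      have h1 := k.2
      have h2 := l.2
      simp only at hkl
      exact Subtype.ext (by omega)
    calc h N x = ∑' k : {k : ℤ // k ≤ N}, a k * gridTerm α ℓ f b k x := by
          rw [show (∑' k : {k : ℤ // k ≤ N}, a k * gridTerm α ℓ f b k x) =
            ∑' k : ({k : ℤ | k ≤ N} : Set ℤ), a k * gridTerm α ℓ f b k x from rfl,
            tsum_subtype ({k : ℤ | k ≤ N} : Set ℤ) fun k => a k * gridTerm α ℓ f b k x]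
          refine tsum_congr fun k => ?_
          rw [Set.indicator_apply]
          rfl
      _ = ∑' k : {k : ℤ // k ≤ N}, g (N - k.1).toNat := by
          refine tsum_congr fun k => ?_
          have : (N : ℤ) - ((N - k.1).toNat : ℤ) = k.1 := by
            have := k.2
            omega
          simp only [g, this]
      _ ≤ ∑' t, g t := ENNReal.tsum_comp_le_tsum_of_injective hinj g
  · intro N
    refine AEMeasurable.mul (AEMeasurable.pow_const ?_ p) hwm
    refine AEMeasurable.tsum fun k => ?_
    split_ifs
    · exact (aemeasurable_gridTerm α ℓ f hb k).const_mul _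
    · exact aemeasurable_const
  · refine Filter.Eventually.of_forall fun x N M hNM => ?_
    have := hmono x hNM
    dsimp only at this ⊢
    gcongr

end Domination

section Discretization

variable {n m : ℕ}

lemma enorm_finset_prod {ι : Type*} (s : Finset ι) (u : ι → ℝ) :
    ‖∏ i ∈ s, u i‖ₑ = ∏ i ∈ s, ‖u i‖ₑ := by
  simp only [enorm_eq_nnnorm, nnnorm_prod, ENNReal.ofNNReal_finsetProd]

lemma aemeasurable_prod_comp_eval {E : Type*} [MeasurableSpace E] {μ : Fin m → Measure E}
    [∀ i, SigmaFinite (μ i)] {g : Fin m → E → ℝ≥0∞} (hg : ∀ i, AEMeasurable (g i) (μ i)) :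
    AEMeasurable (fun y : Fin m → E => ∏ i, g i (y i)) (Measure.pi μ) :=
  Finset.aemeasurable_fun_prod _ fun i _ =>
    (hg i).comp_quasiMeasurePreserving (Measure.quasiMeasurePreserving_eval μ i)

/-- Tonelli's theorem for products of functions of one coordinate each. -/
lemma lintegral_pi_prod_eq {E : Type*} [MeasurableSpace E] : ∀ {m : ℕ} {μ : Fin m → Measure E}
    [∀ i, SigmaFinite (μ i)] {g : Fin m → E → ℝ≥0∞}, (∀ i, AEMeasurable (g i) (μ i)) →
    ∫⁻ y, ∏ i, g i (y i) ∂(Measure.pi μ) = ∏ i, ∫⁻ y, g i y ∂(μ i)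
  | 0, μ, _, g, _ => by simp
  | m + 1, μ, _, g, hg => by
    rw [← ((measurePreserving_piFinSuccAbove μ 0).symm).lintegral_comp_emb
      (MeasurableEquiv.measurableEmbedding _)]
    simp_rw [MeasurableEquiv.piFinSuccAbove_symm_apply, Fin.insertNthEquiv,
      Fin.prod_univ_succ, Fin.insertNth_zero, Equiv.coe_fn_mk, Fin.cons_succ,
      Fin.zero_succAbove, cast_eq, Fin.cons_zero]
    rw [lintegral_prod_mul (hg 0) (aemeasurable_prod_comp_eval fun i => hg i.succ),
      lintegral_pi_prod_eq fun i => hg i.succ]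

/-- The mass of the kernel on an annulus. -/
def annulusMass (φ : (Fin m → Rn n) → ℝ) (δ ε : ℝ) (k : ℤ) : ℝ≥0∞ :=
  ∫⁻ y in annulus n m ((2 : ℝ) ^ k) δ ε, ENNReal.ofReal (φ y)

lemma measurableSet_annulus (t δ ε : ℝ) : MeasurableSet (annulus n m t δ ε) := by
  have hc : Continuous fun y : Fin m → Rn n => ∑ i, ‖y i‖ :=
    continuous_finsetSum _ fun i _ => (continuous_apply i).norm
  exact (measurableSet_lt measurable_const hc.measurable).inter
    (measurableSet_le hc.measurable measurable_const)

lemma tsum_annulusMass_le_Phi (φ : (Fin m → Rn n) → ℝ) (δ ε : ℝ) {θ : ℝ} (hθ : 0 < θ) (N : ℤ)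
    (u : ℕ) :
    ∑' t : ℕ, (if u ≤ t then annulusMass φ δ ε (N - t - 4) ^ θ else 0) ≤
      Phi φ δ ε θ (2 ^ (N - u)) ^ θ := by
  rw [Phi, ← ENNReal.rpow_mul, one_div_mul_cancel hθ.ne', ENNReal.rpow_one]
  have hle : ∀ t : {t : ℕ // u ≤ t}, (2 : ℝ) ^ (-(-(N - t.1 - 4 : ℤ))) ≤ 2 ^ (N - (u : ℤ)) := by
    intro t
    refine zpow_le_zpow_right₀ one_le_two ?_
    have := t.2
    omega
  let g : {t : ℕ // u ≤ t} → {ν : ℤ // (2 : ℝ) ^ (-ν) ≤ 2 ^ (N - (u : ℤ))} :=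
    fun t => ⟨-(N - t.1 - 4 : ℤ), hle t⟩
  have hg : Function.Injective g := by
    intro s t h
    have := congrArg (fun z => z.1) h
    simp only [g] at this
    exact Subtype.ext (by omega)
  refine le_trans (le_of_eq ?_) (ENNReal.tsum_comp_le_tsum_of_injective hg _)
  calc ∑' t : ℕ, (if u ≤ t then annulusMass φ δ ε (N - t - 4) ^ θ else 0)
      = ∑' t : ({t : ℕ | u ≤ t} : Set ℕ), annulusMass φ δ ε (N - t - 4) ^ θ := by
        rw [tsum_subtype ({t : ℕ | u ≤ t} : Set ℕ) fun t : ℕ => annulusMass φ δ ε (N - t - 4) ^ θ]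
        refine tsum_congr fun t => ?_
        rw [Set.indicator_apply]
        rfl
    _ = _ := by
        refine tsum_congr fun t => ?_
        simp only [g, neg_neg]
        rfl

/-- Discretization of a positive multilinear integral along the shifted dyadic grids. -/
lemma exists_lintegral_mul_prod_le (hn : 0 < n) (hm : 0 < m) {φ : (Fin m → Rn n) → ℝ} {δ ε : ℝ}
    (hφ : CondD φ δ ε) : ∃ C : ℝ≥0, ∀ (g : Fin m → Rn n → ℝ≥0∞), (∀ i, AEMeasurable (g i)) →
    ∀ x : Rn n, ∫⁻ y : Fin m → Rn n, ENNReal.ofReal (φ fun i => x - y i) * ∏ i, g i (y i) ≤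
      C * ∑ α : Fin n → Fin 2, ∑' k : ℤ, annulusMass φ δ ε (k - 4) *
        ∏ i, ((∫⁻ y in gridCube α k (gridIndex α k x), g i y) /
          volume (gridCube α k (gridIndex α k x))) := by
  obtain ⟨C, hC0, hC⟩ := hφ.growth
  have hmass : ∀ k : ℤ, ENNReal.ofReal (∫ y in annulus n m ((2 : ℝ) ^ k) δ ε, φ y) ≤
      annulusMass φ δ ε k := by
    intro k
    rw [integral_eq_lintegral_of_nonneg_ae (Filter.Eventually.of_forall hφ.nonneg)
      hφ.locallyIntegrable.aestronglyMeasurable.restrict]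
    exact ENNReal.ofReal_toReal_le
  refine ⟨C.toNNReal * 16 ^ (n * m), fun g hg x => ?_⟩
  let A : ℤ → Set (Fin m → Rn n) := fun k =>
    {y | (fun i => x - y i) ∈ annulus n m ((2 : ℝ) ^ k) 1 0}
  have hA : ∀ k, MeasurableSet (A k) := fun k => by
    have hc : Continuous fun (y : Fin m → Rn n) (i : Fin m) => x - y i :=
      continuous_pi fun i => continuous_const.sub (continuous_apply i)
    exact hc.measurable (measurableSet_annulus _ _ _)
  have hcover : ∀ y : Fin m → Rn n, y ≠ (fun _ => x) → ∃ k, y ∈ A k := by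
    intro y hy
    have hpos : 0 < ∑ i, ‖x - y i‖ := by
      obtain ⟨i, hi⟩ := Function.ne_iff.1 hy
      refine Finset.sum_pos' (fun i _ => norm_nonneg _) ⟨i, Finset.mem_univ i, ?_⟩
      exact norm_pos_iff.2 (sub_ne_zero.2 fun h => hi h.symm)
    obtain ⟨k, hk1, hk2⟩ := exists_mem_Ioc_zpow hpos (one_lt_two (α := ℝ))
    refine ⟨k, ?_, ?_⟩
    · simpa using hk1
    · rw [zpow_add_one₀ two_ne_zero] at hk2
      simp only [add_zero, mul_one, one_mul]
      linarith
  have hnull : (⋃ k, A k : Set (Fin m → Rn n)) =ᵐ[volume] Set.univ := by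
    rw [ae_eq_univ]
    have hx0 : volume ({x} : Set (Rn n)) = 0 := by
      refine measure_mono_null (t := cube x 0) ?_ ?_
      · rintro _ rfl i
        simp
      · rw [volume_cube, ENNReal.ofReal_zero, zero_pow hn.ne']
    refine measure_mono_null (t := Set.univ.pi fun _ => {x}) ?_ ?_
    swap
    · rw [volume_pi_pi, Finset.prod_const, hx0, Finset.card_univ, Fintype.card_fin,
        zero_pow hm.ne']
    intro y hy
    by_contra hne'
    have hne : y ≠ fun _ => x := fun h => hne' (by simp [h])
    obtain ⟨k, hk⟩ := hcover y hne
    exact hy (Set.mem_iUnion.2 ⟨k, hk⟩)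
  have hterm : ∀ k : ℤ, ∫⁻ y in A k, ENNReal.ofReal (φ fun i => x - y i) * ∏ i, g i (y i) ≤
      (C.toNNReal * 16 ^ (n * m) : ℝ≥0) * ∑ α : Fin n → Fin 2, annulusMass φ δ ε k *
        ∏ i, ((∫⁻ y in gridCube α (k + 4) (gridIndex α (k + 4) x), g i y) /
          volume (gridCube α (k + 4) (gridIndex α (k + 4) x))) := by
    intro k
    obtain ⟨α, hα⟩ := exists_closedBall_subset_gridIndex k x
    set Q : Set (Rn n) := {y | gridIndex α (k + 4) y = gridIndex α (k + 4) x}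
    set V := volume (gridCube α (k + 4) (gridIndex α (k + 4) x)) with hV
    set c : ℝ≥0∞ := ENNReal.ofReal (C / (2 : ℝ) ^ (k * n * m)) with hc
    have hAQ : A k ⊆ Set.univ.pi fun _ => Q := by
      intro y hy i _
      refine hα (y i) ?_
      refine (Finset.single_le_sum (f := fun i => ‖x - y i‖) (fun i _ => norm_nonneg _)
        (Finset.mem_univ i)).trans (hy.2.trans (le_of_eq ?_))
      ring
    have hV2 : c = C.toNNReal * 16 ^ (n * m) / V ^ m := by
      have hV3 : V ^ m = ENNReal.ofReal ((2 : ℝ) ^ (k * n * m) * 16 ^ (n * m)) := by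
        rw [hV, gridCube, volume_cube, ← ENNReal.ofReal_pow (by positivity),
          ← ENNReal.ofReal_pow (by positivity)]
        congr 1
        rw [zpow_add₀ two_ne_zero, ← pow_mul, mul_pow]
        congr 1
        · rw [mul_assoc, zpow_mul, ← Nat.cast_mul, zpow_natCast]
        · norm_num
      rw [hV3, hc, show ((C.toNNReal : ℝ≥0∞) * 16 ^ (n * m)) =
          ENNReal.ofReal (C * 16 ^ (n * m)) by
        rw [ENNReal.ofReal_mul hC0.le, ENNReal.ofReal_pow (by norm_num), ENNReal.ofReal_ofNat]
        rfl, ← ENNReal.ofReal_div_of_pos (by positivity)]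
      congr 1
      field_simp
    calc ∫⁻ y in A k, ENNReal.ofReal (φ fun i => x - y i) * ∏ i, g i (y i)
        ≤ ∫⁻ y in A k, (c * annulusMass φ δ ε k) * ∏ i, g i (y i) := by
          refine setLIntegral_mono' (hA k) fun y hy => ?_
          gcongr
          refine (ENNReal.ofReal_le_ofReal (hC k _ hy)).trans ?_
          rw [ENNReal.ofReal_mul (by positivity)]
          gcongr
          exact hmass k
      _ ≤ ∫⁻ y in Set.univ.pi fun _ => Q, (c * annulusMass φ δ ε k) * ∏ i, g i (y i) :=
          lintegral_mono_set hAQ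
      _ = (c * annulusMass φ δ ε k) * ∏ i, ∫⁻ y in Q, g i y := by
          rw [volume_pi, Measure.restrict_pi_pi, lintegral_const_mul'' _
            (aemeasurable_prod_comp_eval fun i => (hg i).restrict),
            lintegral_pi_prod_eq fun i => (hg i).restrict]
      _ = (C.toNNReal * 16 ^ (n * m) : ℝ≥0) * (annulusMass φ δ ε k *
            ∏ i, ((∫⁻ y in gridCube α (k + 4) (gridIndex α (k + 4) x), g i y) / V)) := by
          rw [show (volume.restrict Q : Measure (Rn n)) =
            volume.restrict (gridCube α (k + 4) (gridIndex α (k + 4) x)) from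
            restrict_setOf_gridIndex α (k + 4) _, hV2]
          simp_rw [div_eq_mul_inv]
          rw [Finset.prod_mul_distrib, Finset.prod_const, Finset.card_univ, Fintype.card_fin,
            ENNReal.inv_pow]
          push_cast
          ring
      _ ≤ _ := by
          gcongr
          exact Finset.single_le_sum (f := fun α : Fin n → Fin 2 => annulusMass φ δ ε k *
            ∏ i, ((∫⁻ y in gridCube α (k + 4) (gridIndex α (k + 4) x), g i y) /
              volume (gridCube α (k + 4) (gridIndex α (k + 4) x))))
            (fun _ _ => bot_le) (Finset.mem_univ α)
  calc ∫⁻ y : Fin m → Rn n, ENNReal.ofReal (φ fun i => x - y i) * ∏ i, g i (y i)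
      = ∫⁻ y in ⋃ k, A k, ENNReal.ofReal (φ fun i => x - y i) * ∏ i, g i (y i) := by
        rw [setLIntegral_congr hnull, setLIntegral_univ]
    _ ≤ ∑' k : ℤ, ∫⁻ y in A k, ENNReal.ofReal (φ fun i => x - y i) * ∏ i, g i (y i) :=
        lintegral_iUnion_le _ _
    _ ≤ _ := ENNReal.tsum_le_tsum hterm
    _ = _ := by
        rw [ENNReal.tsum_mul_left, Summable.tsum_finsetSum fun _ _ => ENNReal.summable]
        congr 1
        refine Finset.sum_congr rfl fun α _ => ?_
        conv_rhs => rw [← (Equiv.addRight (4 : ℤ)).tsum_eq]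
        simp

end Discretization

section Pointwise

variable {n m : ℕ}

/-- Pointwise domination of the potential operator. -/
lemma exists_enorm_potential_le (hn : 0 < n) (hm : 0 < m) {φ : (Fin m → Rn n) → ℝ} {δ ε : ℝ}
    (hφ : CondD φ δ ε) (ℓ : ℕ) : ∃ C : ℝ≥0, ∀ (f : Fin m → Rn n → ℝ),
    (∀ i, AEStronglyMeasurable (f i)) → ∀ x : Rn n,
    ‖potential φ f x‖ₑ ≤ C * ∑ α : Fin n → Fin 2, ∑' k : ℤ, annulusMass φ δ ε (k - 4) *
      gridTerm α ℓ f (fun _ : Fin 0 => 0) k x := by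
  obtain ⟨C, hC⟩ := exists_lintegral_mul_prod_le hn hm hφ
  refine ⟨C, fun f hf x => ?_⟩
  calc ‖potential φ f x‖ₑ ≤ ∫⁻ y : Fin m → Rn n, ‖φ (fun i => x - y i) * ∏ i, f i (y i)‖ₑ :=
        enorm_integral_le_lintegral_enorm _
    _ = ∫⁻ y : Fin m → Rn n, ENNReal.ofReal (φ fun i => x - y i) * ∏ i, ‖f i (y i)‖ₑ := by
        refine lintegral_congr fun y => ?_
        rw [enorm_mul, Real.enorm_of_nonneg (hφ.nonneg _), enorm_finset_prod]
    _ ≤ _ := hC (fun i y => ‖f i y‖ₑ) (fun i => (hf i).enorm) x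
    _ ≤ _ := by
        gcongr with α _ k
        rw [gridTerm]
        simp only [Finset.univ_eq_empty, Finset.sum_empty, add_zero, one_mul]
        refine Finset.prod_le_prod' fun i _ => ?_
        rw [← setLAverage_eq]
        exact laverage_enorm_le_luxAvg ℓ (f i) _

/-- Pointwise domination of the commutator. -/
lemma exists_enorm_commutator_le (hn : 0 < n) (hm : 0 < m) {φ : (Fin m → Rn n) → ℝ} {δ ε : ℝ}
    (hφ : CondD φ δ ε) (K : ℝ≥0) : ∃ C : ℝ≥0, ∀ (b f : Fin m → Rn n → ℝ),
    (∀ j, LocallyIntegrable (b j)) → (∀ j, bmoNorm (b j) ≤ K) →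
    (∀ i, AEStronglyMeasurable (f i)) → ∀ x : Rn n,
    ‖commutator b φ f x‖ₑ ≤ C * ∑ α : Fin n → Fin 2, ∑' k : ℤ, annulusMass φ δ ε (k - 4) *
      gridTerm α 1 f b k x := by
  obtain ⟨C, hC⟩ := exists_lintegral_mul_prod_le hn hm hφ
  obtain ⟨C₁, hC₁⟩ := exists_laverage_sub_mul_le_luxAvg (n := n) K
  refine ⟨m * (C + C * (1 + C₁)), fun b f hb hK hf x => ?_⟩
  set R : ℝ≥0∞ := ∑ α : Fin n → Fin 2, ∑' k : ℤ, annulusMass φ δ ε (k - 4) * gridTerm α 1 f b k x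
    with hR
  set g : Fin m → Rn n → ℝ≥0∞ := fun i y => ‖f i y‖ₑ with hgdef
  have hg : ∀ i, AEMeasurable (g i) := fun i => (hf i).enorm
  have havg : ∀ (α : Fin n → Fin 2) (k : ℤ) (i : Fin m),
      (∫⁻ y in gridCube α k (gridIndex α k x), g i y) /
        volume (gridCube α k (gridIndex α k x)) ≤
      luxAvg (youngLog 1) (f i) (gridCube α k (gridIndex α k x)) := by
    intro α k i
    rw [← setLAverage_eq]
    exact laverage_enorm_le_luxAvg 1 (f i) _
  have hW0 : ∫⁻ y : Fin m → Rn n, ENNReal.ofReal (φ fun i => x - y i) * ∏ i, g i (y i) ≤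
      C * R := by
    refine (hC g hg x).trans ?_
    rw [hR]
    gcongr with α _ k
    refine (Finset.prod_le_prod' fun i _ => havg α k i).trans ?_
    exact le_mul_of_one_le_left bot_le le_self_add
  let G : Fin m → Fin m → Rn n → ℝ≥0∞ := fun j =>
    Function.update g j fun y => ‖b j x - b j y‖ₑ * ‖f j y‖ₑ
  have hG : ∀ j i, AEMeasurable (G j i) := by
    intro j i
    by_cases h : i = j
    · subst h
      simp only [G, Function.update_self]
      exact ((aestronglyMeasurable_const.sub (hb i).aestronglyMeasurable).enorm).mul (hf i).enorm
    · simp only [G, Function.update_of_ne h]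
      exact hg i
  have hWj : ∀ j, ∫⁻ y : Fin m → Rn n, ENNReal.ofReal (φ fun i => x - y i) * ∏ i, G j i (y i) ≤
      C * (1 + C₁) * R := by
    intro j
    refine (hC (G j) (hG j) x).trans ?_
    rw [mul_assoc]
    refine mul_le_mul_right ?_ _
    rw [hR, Finset.mul_sum]
    refine Finset.sum_le_sum fun α _ => ?_
    rw [← ENNReal.tsum_mul_left]
    refine ENNReal.tsum_le_tsum fun k => ?_
    set Q := gridCube α k (gridIndex α k x) with hQ
    have hV0 : volume Q ≠ 0 := volume_cube_ne_zero _ (by positivity)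
    have hVt : volume Q ≠ ∞ := volume_cube_ne_top _ _
    set a : ℝ := ⨍ y in Q, b j y ∂volume
    set L : Fin m → ℝ≥0∞ := fun i => luxAvg (youngLog 1) (f i) Q
    have hj : (∫⁻ y in Q, G j j y) / volume Q ≤ (‖b j x - a‖ₑ + C₁) * L j := by
      rw [ENNReal.div_le_iff hV0 hVt]
      calc ∫⁻ y in Q, G j j y
          ≤ ∫⁻ y in Q, (‖b j x - a‖ₑ * ‖f j y‖ₑ + ‖b j y - a‖ₑ * ‖f j y‖ₑ) := by
            refine lintegral_mono fun y => ?_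
            simp only [G, Function.update_self]
            rw [← add_mul]
            gcongr
            calc ‖b j x - b j y‖ₑ = ‖(b j x - a) - (b j y - a)‖ₑ := by congr 1; ring
              _ ≤ _ := enorm_sub_le
        _ = ‖b j x - a‖ₑ * (∫⁻ y in Q, ‖f j y‖ₑ) + ∫⁻ y in Q, ‖b j y - a‖ₑ * ‖f j y‖ₑ := by
            rw [lintegral_add_left' ((hf j).enorm.restrict.const_mul _),
              lintegral_const_mul' _ _ enorm_ne_top]
        _ ≤ ‖b j x - a‖ₑ * (L j * volume Q) + C₁ * L j * volume Q := by
            refine add_le_add (mul_le_mul_right ?_ _) (hC₁ (b j) (hb j) (hK j) (f j) α k _)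
            have := havg α k j
            rwa [ENNReal.div_le_iff hV0 hVt] at this
        _ = _ := by ring
    have hprod : ∏ i, (∫⁻ y in Q, G j i y) / volume Q ≤
        (‖b j x - a‖ₑ + C₁) * ∏ i, L i := by
      rw [← Finset.mul_prod_erase _ _ (Finset.mem_univ j),
        ← Finset.mul_prod_erase _ L (Finset.mem_univ j), ← mul_assoc]
      refine mul_le_mul' hj (Finset.prod_le_prod' fun i hi => ?_)
      have : G j i = g i := Function.update_of_ne (Finset.ne_of_mem_erase hi) _ _
      rw [this]
      exact havg α k i
    calc annulusMass φ δ ε (k - 4) * ∏ i, (∫⁻ y in Q, G j i y) / volume Q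
        ≤ annulusMass φ δ ε (k - 4) * ((‖b j x - a‖ₑ + C₁) * ∏ i, L i) := by gcongr
      _ ≤ annulusMass φ δ ε (k - 4) * (((1 + C₁) * (1 + ∑ j,
            ‖b j x - ⨍ y in Q, b j y ∂volume‖ₑ)) * ∏ i, L i) := by
          gcongr
          have h1 : ‖b j x - a‖ₑ ≤ ∑ j, ‖b j x - ⨍ y in Q, b j y ∂volume‖ₑ :=
            Finset.single_le_sum (f := fun j => ‖b j x - ⨍ y in Q, b j y ∂volume‖ₑ)
              (fun _ _ => bot_le) (Finset.mem_univ j)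
          set s := ∑ j, ‖b j x - ⨍ y in Q, b j y ∂volume‖ₑ
          calc ‖b j x - a‖ₑ + C₁ ≤ s + C₁ := by gcongr
            _ ≤ s + C₁ + (1 + C₁ * s) := le_self_add
            _ = _ := by ring
      _ = _ := by rw [gridTerm]; ring
  have hmφ : AEStronglyMeasurable fun y : Fin m → Rn n => φ fun i => x - y i :=
    hφ.locallyIntegrable.aestronglyMeasurable.comp_quasiMeasurePreserving
      (volume_preserving_pi fun _ : Fin m =>
        Measure.measurePreserving_sub_left (volume : Measure (Rn n)) x).quasiMeasurePreserving
  have heval : ∀ i, Measure.QuasiMeasurePreserving (fun y : Fin m → Rn n => y i) volume volume :=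
    fun i => Measure.quasiMeasurePreserving_eval (fun _ => volume) i
  have hmf : AEStronglyMeasurable fun y : Fin m → Rn n => ∏ i, f i (y i) :=
    Finset.aestronglyMeasurable_fun_prod _ fun i _ =>
      (hf i).comp_quasiMeasurePreserving (heval i)
  have hterm : ∀ j, ‖b j x * potential φ f x
      - potential φ (Function.update f j (fun y => b j y * f j y)) x‖ₑ ≤
      (C + C * (1 + C₁)) * R := by
    intro j
    by_cases hRt : (C : ℝ≥0∞) * R + C * (1 + C₁) * R = ∞
    · rw [add_mul, hRt]; exact le_top
    have ht0 : (C : ℝ≥0∞) * R < ∞ := lt_of_le_of_lt le_self_add (lt_top_iff_ne_top.2 hRt)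
    have htj : (C : ℝ≥0∞) * (1 + C₁) * R < ∞ :=
      lt_of_le_of_lt le_add_self (lt_top_iff_ne_top.2 hRt)
    set F : (Fin m → Rn n) → ℝ := fun y => φ (fun i => x - y i) * ∏ i, f i (y i) with hF
    set D : (Fin m → Rn n) → ℝ := fun y => (b j x - b j (y j)) * F y with hD
    have hFm : AEStronglyMeasurable F := hmφ.mul hmf
    have hDm : AEStronglyMeasurable D :=
      (aestronglyMeasurable_const.sub
        ((hb j).aestronglyMeasurable.comp_quasiMeasurePreserving (heval j))).mul hFm
    have hFe : ∀ y, ‖F y‖ₑ = ENNReal.ofReal (φ fun i => x - y i) * ∏ i, g i (y i) := fun y => by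
      rw [hF, enorm_mul, Real.enorm_of_nonneg (hφ.nonneg _), enorm_finset_prod]
    have hDe : ∀ y, ‖D y‖ₑ = ENNReal.ofReal (φ fun i => x - y i) * ∏ i, G j i (y i) := fun y => by
      have e : ∏ i, G j i (y i) = ‖b j x - b j (y j)‖ₑ * ∏ i, g i (y i) := by
        rw [← Finset.mul_prod_erase _ (fun i => G j i (y i)) (Finset.mem_univ j),
          ← Finset.mul_prod_erase _ (fun i => g i (y i)) (Finset.mem_univ j), ← mul_assoc]
        congr 1
        · simp only [G, Function.update_self, hgdef]
        · refine Finset.prod_congr rfl fun i hi => ?_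
          have : G j i = g i := Function.update_of_ne (Finset.ne_of_mem_erase hi) _ _
          rw [this]
      rw [hD, enorm_mul, hFe, e]; ring
    have hFi : Integrable F := by
      refine ⟨hFm, ?_⟩
      rw [hasFiniteIntegral_iff_enorm]
      simp_rw [hFe]
      exact hW0.trans_lt ht0
    have hDi : Integrable D := by
      refine ⟨hDm, ?_⟩
      rw [hasFiniteIntegral_iff_enorm]
      simp_rw [hDe]
      exact (hWj j).trans_lt htj
    have hpot : potential φ (Function.update f j (fun y => b j y * f j y)) x =
        ∫ y, (b j x * F y - D y) := by
      refine integral_congr_ae (Filter.Eventually.of_forall fun y => ?_)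
      have e : ∏ i, Function.update f j (fun y => b j y * f j y) i (y i) =
          b j (y j) * ∏ i, f i (y i) := by
        rw [← Finset.mul_prod_erase _ (fun i => f i (y i)) (Finset.mem_univ j),
          ← Finset.mul_prod_erase _
            (fun i => Function.update f j (fun y => b j y * f j y) i (y i)) (Finset.mem_univ j),
          ← mul_assoc]
        congr 1
        · rw [Function.update_self]
        · refine Finset.prod_congr rfl fun i hi => ?_
          rw [Function.update_of_ne (Finset.ne_of_mem_erase hi)]
      simp only [e, hD, hF]
      ring
    rw [hpot, integral_sub (hFi.const_mul _) hDi, integral_const_mul]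
    rw [show b j x * potential φ f x - (b j x * (∫ y, F y) - ∫ y, D y) = ∫ y, D y by
      rw [potential]; ring]
    refine (enorm_integral_le_lintegral_enorm _).trans ?_
    simp_rw [hDe]
    refine (hWj j).trans ?_
    gcongr
    exact le_add_self
  calc ‖commutator b φ f x‖ₑ ≤ ∑ j, ‖b j x * potential φ f x
      - potential φ (Function.update f j (fun y => b j y * f j y)) x‖ₑ := enorm_sum_le _ _
    _ ≤ ∑ _j : Fin m, (C + C * (1 + C₁)) * R := Finset.sum_le_sum fun j _ => hterm j
    _ = _ := by
        rw [Finset.sum_const, Finset.card_univ, Fintype.card_fin, nsmul_eq_mul]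
        push_cast
        ring

end Pointwise

/-- Operators dominated pointwise by sums over the shifted dyadic grids are controlled by the
maximal operator in weighted norm. -/
lemma exists_lintegral_rpow_le_maximal {n m : ℕ} (m' : ℕ) (φ : (Fin m → Rn n) → ℝ) (δ ε : ℝ)
    {w : Rn n → ℝ} (hw : MemAInfty w) (K C₀ : ℝ≥0) {θ p : ℝ} (hθ : 0 < θ) (hθ1 : θ ≤ 1)
    (hp : θ ≤ p) : ∃ C : ℝ≥0,
    ∀ (ℓ : ℕ) (f : Fin m → Rn n → ℝ) (b : Fin m' → Rn n → ℝ) (T : Rn n → ℝ),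
      (∀ j, LocallyIntegrable (b j)) → (∀ j, bmoNorm (b j) ≤ K) →
      (∀ x, ‖T x‖ₑ ≤ C₀ * ∑ α : Fin n → Fin 2, ∑' k : ℤ, annulusMass φ δ ε (k - 4) *
        gridTerm α ℓ f b k x) →
      ∫⁻ x, ‖T x‖ₑ ^ p * ENNReal.ofReal (w x) ≤
        C * ∫⁻ x, maximal (Phi φ δ ε θ) (youngLog ℓ) f x ^ p * ENNReal.ofReal (w x) := by
  obtain ⟨C, hC⟩ := exists_lintegral_tsum_int_gridTerm_le n m m' hw K hθ hθ1 hp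
  have hp0 : 0 < p := hθ.trans_le hp
  have hwm : AEMeasurable fun x => ENNReal.ofReal (w x) := by
    obtain ⟨r, -, h, -⟩ := hw
    exact h.locallyIntegrable.aestronglyMeasurable.aemeasurable.ennreal_ofReal
  set c : ℝ≥0 := ((Fintype.card (Fin n → Fin 2) : ℕ) : ℝ≥0) with hc
  refine ⟨(C₀ * c) ^ p * (c * C), fun ℓ f b T hb hK hT => ?_⟩
  set h : (Fin n → Fin 2) → Rn n → ℝ≥0∞ := fun α x =>
    ∑' k : ℤ, annulusMass φ δ ε (k - 4) * gridTerm α ℓ f b k x with hh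
  have hm : ∀ α, AEMeasurable fun x => h α x ^ p * ENNReal.ofReal (w x) := fun α =>
    ((AEMeasurable.tsum fun k => (aemeasurable_gridTerm α ℓ f hb k).const_mul _).pow_const p).mul
      hwm
  have hsum : ∀ x, (∑ α, h α x) ^ p ≤ (c : ℝ≥0∞) ^ p * ∑ α, h α x ^ p := by
    intro x
    obtain ⟨β, -, hβ⟩ := Finset.exists_max_image (Finset.univ (α := Fin n → Fin 2))
      (fun α => h α x) Finset.univ_nonempty
    calc (∑ α, h α x) ^ p ≤ (∑ _α : Fin n → Fin 2, h β x) ^ p := by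
          gcongr with α hα
          exact hβ α hα
      _ = (c : ℝ≥0∞) ^ p * h β x ^ p := by
          rw [Finset.sum_const, Finset.card_univ, nsmul_eq_mul,
            ENNReal.mul_rpow_of_nonneg _ _ hp0.le, hc]
          simp
      _ ≤ _ := by
          gcongr
          exact Finset.single_le_sum (f := fun α => h α x ^ p) (fun _ _ => bot_le)
            (Finset.mem_univ β)
  have hDt : ((C₀ : ℝ≥0∞) * c) ^ p ≠ ∞ := ENNReal.rpow_ne_top_of_nonneg hp0.le
    (ENNReal.mul_ne_top ENNReal.coe_ne_top ENNReal.coe_ne_top)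
  set I := ∫⁻ x, maximal (Phi φ δ ε θ) (youngLog ℓ) f x ^ p * ENNReal.ofReal (w x)
  calc ∫⁻ x, ‖T x‖ₑ ^ p * ENNReal.ofReal (w x)
      ≤ ∫⁻ x, ((C₀ : ℝ≥0∞) * c) ^ p * ∑ α, h α x ^ p * ENNReal.ofReal (w x) := by
        refine lintegral_mono fun x => ?_
        rw [← Finset.sum_mul, ← mul_assoc]
        gcongr
        calc ‖T x‖ₑ ^ p ≤ (C₀ * ∑ α, h α x) ^ p := by
              gcongr
              exact hT x
          _ ≤ (C₀ : ℝ≥0∞) ^ p * ((c : ℝ≥0∞) ^ p * ∑ α, h α x ^ p) := by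
              rw [ENNReal.mul_rpow_of_nonneg _ _ hp0.le]
              gcongr
              exact hsum x
          _ = _ := by rw [ENNReal.mul_rpow_of_nonneg _ _ hp0.le, mul_assoc]
    _ = ((C₀ : ℝ≥0∞) * c) ^ p * ∑ α, ∫⁻ x, h α x ^ p * ENNReal.ofReal (w x) := by
        rw [lintegral_const_mul' _ _ hDt, lintegral_finsetSum' _ fun α _ => hm α]
    _ ≤ ((C₀ : ℝ≥0∞) * c) ^ p * ∑ _α : Fin n → Fin 2, C * I := by
        gcongr with α
        exact hC (fun k => annulusMass φ δ ε (k - 4)) (Phi φ δ ε θ)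
          (fun N u => tsum_annulusMass_le_Phi φ δ ε hθ N u) α ℓ f b hb hK
    _ = _ := by
        rw [Finset.sum_const, Finset.card_univ, nsmul_eq_mul, ENNReal.coe_mul, ENNReal.coe_mul,
          ENNReal.coe_rpow_of_nonneg _ hp0.le, ENNReal.coe_mul, hc]
        simp only [ENNReal.coe_natCast]
        ring

/-- The estimate for the potential operator. -/
lemma exists_lintegral_potential_le {n m : ℕ} (hn : 0 < n) (hm : 0 < m)
    {φ : (Fin m → Rn n) → ℝ} {δ ε : ℝ} (hφ : CondD φ δ ε) {w : Rn n → ℝ} (hw : MemAInfty w)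
    {θ p : ℝ} (hθ : 0 < θ) (hθ1 : θ ≤ 1) (hp : θ ≤ p) : ∃ C : ℝ≥0,
    ∀ f : Fin m → Rn n → ℝ, BddCompactSupp f →
      ∫⁻ x, ‖potential φ f x‖ₑ ^ p * ENNReal.ofReal (w x) ≤
        C * ∫⁻ x, maximal (Phi φ δ ε θ) (youngLog 0) f x ^ p * ENNReal.ofReal (w x) := by
  obtain ⟨C₀, hC₀⟩ := exists_enorm_potential_le hn hm hφ 0
  obtain ⟨C, hC⟩ := exists_lintegral_rpow_le_maximal 0 φ δ ε hw 0 C₀ hθ hθ1 hp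
  exact ⟨C, fun f hf => hC 0 f (fun _ => 0) _ (fun j => j.elim0) (fun j => j.elim0)
    (hC₀ f fun i => (hf i).1)⟩

/-- The estimate for the commutator. -/
lemma exists_lintegral_commutator_le {n m : ℕ} (hn : 0 < n) (hm : 0 < m)
    {φ : (Fin m → Rn n) → ℝ} {δ ε : ℝ} (hφ : CondD φ δ ε) {w : Rn n → ℝ} (hw : MemAInfty w)
    {θ p : ℝ} (hθ : 0 < θ) (hθ1 : θ ≤ 1) (hp : θ ≤ p) (K : ℝ≥0) : ∃ C : ℝ≥0,
    ∀ b f : Fin m → Rn n → ℝ, (∀ j, MemBMO (b j)) → bmoNormVec b ≤ K → BddCompactSupp f →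
      ∫⁻ x, ‖commutator b φ f x‖ₑ ^ p * ENNReal.ofReal (w x) ≤
        C * ∫⁻ x, maximal (Phi φ δ ε θ) (youngLog 1) f x ^ p * ENNReal.ofReal (w x) := by
  obtain ⟨C₀, hC₀⟩ := exists_enorm_commutator_le hn hm hφ K
  obtain ⟨C, hC⟩ := exists_lintegral_rpow_le_maximal m φ δ ε hw K C₀ hθ hθ1 hp
  refine ⟨C, fun b f hb hK hf => ?_⟩
  have hKj : ∀ j, bmoNorm (b j) ≤ K := fun j => (le_iSup (fun j => bmoNorm (b j)) j).trans hK
  exact hC 1 f b _ (fun j => (hb j).1) hKj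
    (hC₀ b f (fun j => (hb j).1) hKj fun i => (hf i).1)

end MultilinearPotential

end

theorem mainTheorem2 (n m : ℕ) (hn : 0 < n) (hm : 0 < m)
    (φ : (Fin m → MultilinearPotential.Rn n) → ℝ) (δ ε : ℝ)
    (hφ : MultilinearPotential.CondD φ δ ε)
    (w : MultilinearPotential.Rn n → ℝ) (hw : MultilinearPotential.MemAInfty w) :
    (∀ p : ℝ, 0 < p → p ≤ 1 →
      ∃ C : ℝ≥0, ∀ f : Fin m → MultilinearPotential.Rn n → ℝ,
        MultilinearPotential.BddCompactSupp f →
        ∫⁻ x, ‖MultilinearPotential.potential φ f x‖ₑ ^ p * ENNReal.ofReal (w x) ≤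
          C * ∫⁻ x, MultilinearPotential.maximal (MultilinearPotential.Phi φ δ ε p)
            (MultilinearPotential.youngLog 0) f x ^ p * ENNReal.ofReal (w x)) ∧
    (∀ p : ℝ, 0 < p → p ≤ 1 → MultilinearPotential.MemRH (1 / p) w →
      ∀ K : ℝ≥0, ∃ C : ℝ≥0, ∀ b f : Fin m → MultilinearPotential.Rn n → ℝ,
        (∀ j, MultilinearPotential.MemBMO (b j)) →
        MultilinearPotential.bmoNormVec b ≤ K →
        MultilinearPotential.BddCompactSupp f →
        ∫⁻ x, ‖MultilinearPotential.commutator b φ f x‖ₑ ^ p * ENNReal.ofReal (w x) ≤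
          C * ∫⁻ x, MultilinearPotential.maximal (MultilinearPotential.Phi φ δ ε p)
            (MultilinearPotential.youngLog 1) f x ^ p * ENNReal.ofReal (w x)) ∧
    (∀ p : ℝ, 1 < p → ∀ ℓ : Fin 2,
      ∀ K : ℝ≥0, ∃ C : ℝ≥0, ∀ b f : Fin m → MultilinearPotential.Rn n → ℝ,
        (∀ j, MultilinearPotential.MemBMO (b j)) →
        MultilinearPotential.bmoNormVec b ≤ K →
        MultilinearPotential.BddCompactSupp f →
        ∫⁻ x, ‖MultilinearPotential.potentialComm ℓ b φ f x‖ₑ ^ p * ENNReal.ofReal (w x) ≤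
          C * ∫⁻ x, MultilinearPotential.maximal (MultilinearPotential.Phi φ δ ε 1)
            (MultilinearPotential.youngLog (ℓ : ℕ)) f x ^ p * ENNReal.ofReal (w x)) := by
  refine ⟨fun p hp hp1 => ?_, fun p hp hp1 _ K => ?_, fun p hp ℓ K => ?_⟩
  · exact MultilinearPotential.exists_lintegral_potential_le hn hm hφ hw hp hp1 le_rfl
  · exact MultilinearPotential.exists_lintegral_commutator_le hn hm hφ hw hp hp1 le_rfl K
  · fin_cases ℓ
    · obtain ⟨C, hC⟩ := MultilinearPotential.exists_lintegral_potential_le hn hm hφ hw one_pos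
        le_rfl hp.le
      exact ⟨C, fun _ f _ _ hf => hC f hf⟩
    · exact MultilinearPotential.exists_lintegral_commutator_le hn hm hφ hw one_pos le_rfl hp.le K
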